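/- \textbf{Setting.} Let $n,T,K\ge 1$ be integers. Let $\mathcal D_1,\dots,\mathcal D_n$ be probability distributions on a common sample space, and $F(u,v;\xi)$ a loss function of $u\in\mathbb R^{d_u}$, $v\in\mathbb R^{d_v}$ and a sample $\xi$. Put $$f_i(u,v)=\mathbb E_{\xi\sim\mathcal D_i}[F(u,v;\xi)]\quad\text{(assumed to exist)},\qquad f(u,\mathbf v)=\frac1n\sum_{i=1}^n f_i(u,v_i),\quad \mathbf v=(v_1,\dots,v_n)\in(\mathbb R^{d_v})^n,$$ and assume that $f$ is bounded below. \textbf{Smoothness.} Each $f_i$ is differentiable in $u$ and in $v$; $\nabla_u f_i(u,v)$ is $L_u$-Lipschitz in $u$ and $L_{uv}$-Lipschitz in $v$; $\nabla_v f_i(u,v)$ is $L_v$-Lipschitz in $v$ and $L_{vu}$-Lipschitz in $u$. Let $L=\max\{L_u,L_v,L_{uv},L_{vu}\}$. \textbf{Stochastic gradients.} For all $i,u,v$ and $\xi_i\sim\mathcal D_i$, the gradients $\nabla_uF(u,v;\xi_i)$ and $\nabla_vF(u,v;\xi_i)$ exist almost surely, $\mathbb E[\nabla_uF(u,v;\xi_i)]=\nabla_uf_i(u,v)$,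 $\mathbb E[\nabla_vF(u,v;\xi_i)]=\nabla_vf_i(u,v)$, $\mathbb E\|\nabla_uF(u,v;\xi_i)-\nabla_uf_i(u,v)\|^2\le\sigma_u^2$ and $\mathbb E\|\nabla_vF(u,v;\xi_i)-\nabla_vf_i(u,v)\|^2\le\sigma_v^2$. The sample gradients are measurable in $(u,v,\xi)$. \textbf{Algorithm (FedAvg-P with full participation).} Let $\xi_{i,k}^t\sim\mathcal D_i$ ($1\le i\le n$, $0\le t<T$, $0\le k<K$) be mutually independent. From a deterministic starting point $(u^0,\mathbf v^0)$, for $t=0,\dots,T-1$ every client $i$ sets $u_{i,0}^t=u^t$, $v_{i,0}^t=v_i^t$ and, for $k=0,\dots,K-1$, $$u_{i,k+1}^t=u_{i,k}^t-\gamma_u\nabla_uF(u_{i,k}^t,v_{i,k}^t;\xi_{i,k}^t),\qquad v_{i,k+1}^t=v_{i,k}^t-\gamma_v\nabla_vF(u_{i,k}^t,v_{i,k}^t;\xi_{i,k}^t);$$ then $u^{t+1}=(1-\eta_u)u^t+\frac{\eta_u}{n}\sum_{i=1}^nu_{i,K}^t$ and $v_i^{t+1}=(1-\eta_v)v_i^t+\eta_vv_{i,K}^t$.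 The step sizes satisfy $\gamma_u\eta_u=\gamma_v\eta_v=:\gamma>0$. \textbf{Quantities.} Let $$\mathcal G_u^t=\mathbb E\|\nabla_uf(u^t,\mathbf v^t)\|^2,\quad \mathcal G_{\mathbf v}^t=\frac1n\sum_{i=1}^n\mathbb E\|\nabla_vf_i(u^t,v_i^t)\|^2,\quad F_0=f(u^0,\mathbf v^0)-\inf f,\quad \mathcal B^0=\sum_{i=1}^n\|\nabla_uf_i(u^0,v_i^0)\|^2,$$ and assume $F_0>0$. \textbf{Theorem.} Suppose $\eta_u\ge\max\Big(T,\sqrt{\frac{\mathcal B^0T}{nLF_0}},\sqrt n\Big)$ and $\eta_v\ge1$. Then all expectations $\mathcal G_u^t,\mathcal G_{\mathbf v}^t$ ($0\le t<T$) are finite, and: (1) if $\gamma\le\frac1{84LK}$, then $$\frac1T\sum_{t=0}^{T-1}\big(\mathcal G_u^t+\mathcal G_{\mathbf v}^t\big)\le\frac{4F_0}{TK\gamma}+44L\Big(\frac{\sigma_u^2}{n}+\sigma_v^2\Big)\gamma+\frac{LF_0}{T};$$ (2) if $\gamma=\Big(84LK+\sqrt{\frac{11LKT}{F_0}\big(\frac{\sigma_u^2}{n}+\sigma_v^2\big)}\Big)^{-1}$,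 then $$\frac1T\sum_{t=0}^{T-1}\big(\mathcal G_u^t+\mathcal G_{\mathbf v}^t\big)\le8\sqrt{\frac{11LF_0}{KT}\Big(\frac{\sigma_u^2}{n}+\sigma_v^2\Big)}+\frac{337LF_0}{T}.$$ -/

import Mathlib

open MeasureTheory ProbabilityTheory

noncomputable section

namespace FedAvgP

/-- The Euclidean space of dimension `d`. -/
abbrev Vec (d : ℕ) := EuclideanSpace ℝ (Fin d)

/-- Partial gradient with respect to the shared variable `u`. -/
def gradU {du dv : ℕ} (g : Vec du → Vec dv → ℝ) (u : Vec du) (v : Vec dv) : Vec du :=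
  gradient (fun u' => g u' v) u

/-- Partial gradient with respect to the personal variable `v`. -/
def gradV {du dv : ℕ} (g : Vec du → Vec dv → ℝ) (u : Vec du) (v : Vec dv) : Vec dv :=
  gradient (fun v' => g u v') v

/-- The objective `f_i(u, v_i) = E_{z ∼ D_i} F(u, v_i; z)` of client `i`. -/
def clientObj {du dv n : ℕ} {Ξ : Type*} [MeasurableSpace Ξ]
    (F : Vec du → Vec dv → Ξ → ℝ) (D : Fin n → Measure Ξ) (i : Fin n)
    (u : Vec du) (v : Vec dv) : ℝ :=
  ∫ z, F u v z ∂(D i)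

/-- The global objective `f(u, v) = (1/n) ∑ i, f_i(u, v_i)`. -/
def globalObj {du dv n : ℕ} {Ξ : Type*} [MeasurableSpace Ξ]
    (F : Vec du → Vec dv → Ξ → ℝ) (D : Fin n → Measure Ξ)
    (u : Vec du) (v : Fin n → Vec dv) : ℝ :=
  (1 / (n : ℝ)) * ∑ i, clientObj F D i u (v i)

/-- The gradient `∇_u f(u, v)` of the global objective in the shared variable. -/
def globalGradU {du dv n : ℕ} {Ξ : Type*} [MeasurableSpace Ξ]
    (F : Vec du → Vec dv → Ξ → ℝ) (D : Fin n → Measure Ξ)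
    (u : Vec du) (v : Fin n → Vec dv) : Vec du :=
  gradient (fun u' => globalObj F D u' v) u

/-- The smoothness assumption on the client objectives, with its four Lipschitz constants. -/
structure Smooth {du dv n : ℕ} (f : Fin n → Vec du → Vec dv → ℝ)
    (Lu Luv Lv Lvu : NNReal) : Prop where
  diff_u : ∀ i v, Differentiable ℝ (fun u => f i u v)
  diff_v : ∀ i u, Differentiable ℝ (fun v => f i u v)
  lip_uu : ∀ i v, LipschitzWith Lu (fun u => gradU (f i) u v)
  lip_uv : ∀ i u, LipschitzWith Luv (fun v => gradU (f i) u v)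
  lip_vv : ∀ i u, LipschitzWith Lv (fun v => gradV (f i) u v)
  lip_vu : ∀ i v, LipschitzWith Lvu (fun u => gradV (f i) u v)

/-- The stochastic gradient assumption: the sample gradients `∇_u F(u, v; z)` and
`∇_v F(u, v; z)`, `z ∼ D_i`, exist almost surely, are unbiased for the gradients of `f_i`, and
have variances at most `σu ^ 2` and `σv ^ 2`.  The `meas` fields say that they are measurable
functions of `(u, v, z)`. -/
structure StochGrad {du dv n : ℕ} {Ξ : Type*} [MeasurableSpace Ξ]
    (F : Vec du → Vec dv → Ξ → ℝ) (D : Fin n → Measure Ξ) (σu σv : ℝ) : Prop where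
  diff_u : ∀ i u v, ∀ᵐ z ∂(D i), DifferentiableAt ℝ (fun u' => F u' v z) u
  diff_v : ∀ i u v, ∀ᵐ z ∂(D i), DifferentiableAt ℝ (fun v' => F u v' z) v
  meas_u : Measurable fun p : Vec du × Vec dv × Ξ =>
    gradU (fun u v => F u v p.2.2) p.1 p.2.1
  meas_v : Measurable fun p : Vec du × Vec dv × Ξ =>
    gradV (fun u v => F u v p.2.2) p.1 p.2.1
  integrable_u : ∀ i u v, Integrable (fun z => gradU (fun u' v' => F u' v' z) u v) (D i)
  integrable_v : ∀ i u v, Integrable (fun z => gradV (fun u' v' => F u' v' z) u v) (D i)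
  unbiased_u : ∀ i u v,
    ∫ z, gradU (fun u' v' => F u' v' z) u v ∂(D i) = gradU (clientObj F D i) u v
  unbiased_v : ∀ i u v,
    ∫ z, gradV (fun u' v' => F u' v' z) u v ∂(D i) = gradV (clientObj F D i) u v
  sq_integrable_u : ∀ i u v, Integrable
    (fun z => ‖gradU (fun u' v' => F u' v' z) u v - gradU (clientObj F D i) u v‖ ^ 2) (D i)
  sq_integrable_v : ∀ i u v, Integrable
    (fun z => ‖gradV (fun u' v' => F u' v' z) u v - gradV (clientObj F D i) u v‖ ^ 2) (D i)
  variance_u : ∀ i u v,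
    ∫ z, ‖gradU (fun u' v' => F u' v' z) u v - gradU (clientObj F D i) u v‖ ^ 2 ∂(D i) ≤ σu ^ 2
  variance_v : ∀ i u v,
    ∫ z, ‖gradV (fun u' v' => F u' v' z) u v - gradV (clientObj F D i) u v‖ ^ 2 ∂(D i) ≤ σv ^ 2

/-- The samples `ξ i t k` (client `i`, round `t < T`, local step `k < K`) are random variables
with laws `D i`, and they are mutually independent. -/
structure Samples {n : ℕ} {Ω Ξ : Type*} [MeasurableSpace Ω] [MeasurableSpace Ξ]
    (P : Measure Ω) (D : Fin n → Measure Ξ) (T K : ℕ) (ξ : Fin n → ℕ → ℕ → Ω → Ξ) : Prop where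
  meas : ∀ i, ∀ t < T, ∀ k < K, Measurable (ξ i t k)
  law : ∀ i, ∀ t < T, ∀ k < K, P.map (ξ i t k) = D i
  indep : iIndepFun (fun (p : Fin n × Fin T × Fin K) => ξ p.1 p.2.1 p.2.2) P

/-- The local iterates `(u_{i,k}, v_{i,k})` of one client in one round, started at `p`, with
sample `z k` used at local step `k`.  Both variables are updated simultaneously. -/
def localIter {du dv : ℕ} {Ξ : Type*} (F : Vec du → Vec dv → Ξ → ℝ) (γu γv : ℝ)
    (z : ℕ → Ξ) (p : Vec du × Vec dv) : ℕ → Vec du × Vec dv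
  | 0 => p
  | k + 1 =>
    let q := localIter F γu γv z p k
    (q.1 - γu • gradU (fun u v => F u v (z k)) q.1 q.2,
      q.2 - γv • gradV (fun u v => F u v (z k)) q.1 q.2)

/-- FedAvg-P with set `S t` of participating clients in round `t` and samples `z i t k`:
the iterate `(u^t, v^t)` at the beginning of round `t`. -/
def fedAvgP {du dv n : ℕ} {Ξ : Type*} (F : Vec du → Vec dv → Ξ → ℝ) (γu γv ηu ηv : ℝ) (K : ℕ)
    (S : ℕ → Finset (Fin n)) (u0 : Vec du) (v0 : Fin n → Vec dv) (z : Fin n → ℕ → ℕ → Ξ) :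
    ℕ → Vec du × (Fin n → Vec dv)
  | 0 => (u0, v0)
  | t + 1 =>
    let s := fedAvgP F γu γv ηu ηv K S u0 v0 z t
    let loc := fun i => localIter F γu γv (z i t) (s.1, s.2 i) K
    ((1 - ηu) • s.1 + (ηu / ((S t).card : ℝ)) • ∑ i ∈ S t, (loc i).1,
      fun i => if i ∈ S t then (1 - ηv) • s.2 i + ηv • (loc i).2 else s.2 i)

/-- `G_u = E ‖∇_u f(u, v)‖ ^ 2` at a random point `X = (u, v)`. -/
def expGradU {du dv n : ℕ} {Ω Ξ : Type*} [MeasurableSpace Ω] [MeasurableSpace Ξ]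
    (F : Vec du → Vec dv → Ξ → ℝ) (D : Fin n → Measure Ξ) (P : Measure Ω)
    (X : Ω → Vec du × (Fin n → Vec dv)) : ℝ :=
  ∫ ω, ‖globalGradU F D (X ω).1 (X ω).2‖ ^ 2 ∂P

/-- `G_v = (1/n) ∑ i, E ‖∇_{v_i} f_i(u, v_i)‖ ^ 2` at a random point `X = (u, v)`. -/
def expGradV {du dv n : ℕ} {Ω Ξ : Type*} [MeasurableSpace Ω] [MeasurableSpace Ξ]
    (F : Vec du → Vec dv → Ξ → ℝ) (D : Fin n → Measure Ξ) (P : Measure Ω)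
    (X : Ω → Vec du × (Fin n → Vec dv)) : ℝ :=
  (1 / (n : ℝ)) * ∑ i, ∫ ω, ‖gradV (clientObj F D i) (X ω).1 ((X ω).2 i)‖ ^ 2 ∂P

/-- The initial gap `F_0 = f(u^0, v^0) - inf f`. -/
def initialGap {du dv n : ℕ} {Ξ : Type*} [MeasurableSpace Ξ]
    (F : Vec du → Vec dv → Ξ → ℝ) (D : Fin n → Measure Ξ)
    (u0 : Vec du) (v0 : Fin n → Vec dv) : ℝ :=
  globalObj F D u0 v0 - ⨅ p : Vec du × (Fin n → Vec dv), globalObj F D p.1 p.2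

/-- `B^0 = ∑ i, ‖∇_u f_i(u^0, v_i^0)‖ ^ 2` (the initial point is deterministic). -/
def initialGradSum {du dv n : ℕ} {Ξ : Type*} [MeasurableSpace Ξ]
    (F : Vec du → Vec dv → Ξ → ℝ) (D : Fin n → Measure Ξ)
    (u0 : Vec du) (v0 : Fin n → Vec dv) : ℝ :=
  ∑ i, ‖gradU (clientObj F D i) u0 (v0 i)‖ ^ 2

end FedAvgP

end

/-! Since `γu * ηu = γv * ηv = γ`, the server relaxation and the local step size merge: one round is
a step of size `γ` along the sum of `K` gradients taken at the local iterates, averaged over clients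
for `u` and separate for each client for `v`, plus sampling noise (`noisyRound_iterate`). Smoothness
then gives the usual descent inequality (`NoisyRound.descent`): the objective decreases by `γ * K /
2` times the squared gradient, up to the drift of the local iterates, the squared noise, and an
inner product of gradient and noise.

The difficulty is the drift. It contains `γu ^ 2` times the mean of the squared client gradients in
`u`, and these may stay large where their average vanishes, as no bound on heterogeneity is assumed.
They are instead compared with their values at the start, at the price of the total displacement
over `T` rounds (`meanGradSq_le`). The displacement is in turn bounded by gradients, noise and
drift. Because `ηu` is large, `γu` is so small compared with `γ` that the factors of `T` disappear,
and `L * K * γ ≤ 1 / 84` makes the loop drift, client gradients, displacement, drift a contraction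
(`sum_rounds_le`).

All of this holds pathwise (`sum_gradSq_le`). Probability enters only when expectations are taken:
the inner product has mean zero, the noise terms within a round are mutually orthogonal, and
averaging over clients divides the `u`-variance by `n`. The local `u`-noise is not averaged, but `√n
≤ ηu` supplies the same factor (`sum_expGrad_le`). -/

noncomputable section

namespace FedAvgP

set_option linter.unusedSectionVars false

/-! ### Inequalities in a Hilbert space. -/

section Hilbert

variable {E : Type*} [NormedAddCommGroup E]

lemma norm_add_sq_le_two_mul (a b : E) : ‖a + b‖ ^ 2 ≤ 2 * ‖a‖ ^ 2 + 2 * ‖b‖ ^ 2 := by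
  have h := norm_add_le a b
  nlinarith [sq_nonneg (‖a‖ - ‖b‖), norm_nonneg (a + b), norm_nonneg a, norm_nonneg b]

lemma norm_sum_sq_le_card_mul {ι : Type*} (s : Finset ι) (f : ι → E) :
    ‖∑ i ∈ s, f i‖ ^ 2 ≤ s.card * ∑ i ∈ s, ‖f i‖ ^ 2 :=
  (pow_le_pow_left₀ (norm_nonneg _) (norm_sum_le _ _) 2).trans sq_sum_le_card_mul_sum_sq

lemma norm_average_sq_le [NormedSpace ℝ E] {n : ℕ} (hn : 1 ≤ n) (f : Fin n → E) :
    ‖(1 / (n : ℝ)) • ∑ i, f i‖ ^ 2 ≤ (1 / (n : ℝ)) * ∑ i, ‖f i‖ ^ 2 := by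
  have hn' : (0 : ℝ) < n := by exact_mod_cast hn
  have h := norm_sum_sq_le_card_mul Finset.univ f
  rw [norm_smul, mul_pow, Real.norm_of_nonneg (by positivity)]
  calc (1 / (n : ℝ)) ^ 2 * ‖∑ i, f i‖ ^ 2 ≤ (1 / (n : ℝ)) ^ 2 * (n * ∑ i, ‖f i‖ ^ 2) := by
        gcongr; simpa using h
    _ = _ := by field_simp

variable [InnerProductSpace ℝ E]

/-- The descent lemma for a function with Lipschitz gradient. -/
lemma le_add_inner_gradient_add_sq [CompleteSpace E] {h : E → ℝ} {h' : E → E} {L : ℝ}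
    (hd : ∀ x, HasGradientAt h (h' x) x) (hL : ∀ x y, ‖h' x - h' y‖ ≤ L * ‖x - y‖) (x y : E) :
    h y ≤ h x + inner ℝ (h' x) (y - x) + L / 2 * ‖y - x‖ ^ 2 := by
  set d := y - x with hdd
  -- The claim is `φ 1 ≤ φ 0`; the Lipschitz bound makes the derivative of `φ` nonpositive on the
  -- unit interval.
  set φ : ℝ → ℝ := fun s => h (x + s • d) - s * inner ℝ (h' x) d - L / 2 * s ^ 2 * ‖d‖ ^ 2
  have hφ : ∀ s, HasDerivAt φ
      (inner ℝ (h' (x + s • d)) d - inner ℝ (h' x) d - L * s * ‖d‖ ^ 2) s := by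
    intro s
    have h1 : HasDerivAt (fun s : ℝ => x + s • d) d s := by
      simpa using ((hasDerivAt_id s).smul_const d).const_add x
    have h2 := (hd (x + s • d)).hasFDerivAt.comp_hasDerivAt s h1
    have h3 : HasDerivAt (fun s : ℝ => s * inner ℝ (h' x) d) (inner ℝ (h' x) d) s := by
      simpa using (hasDerivAt_id s).mul_const (inner ℝ (h' x) d)
    have h4 : HasDerivAt (fun s : ℝ => L / 2 * s ^ 2 * ‖d‖ ^ 2) (L * s * ‖d‖ ^ 2) s := by
      have := ((hasDerivAt_pow 2 s).const_mul (L / 2)).mul_const (‖d‖ ^ 2)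
      exact this.congr_deriv (by push_cast; ring)
    exact (h2.sub h3).sub h4
  have hanti : AntitoneOn φ (Set.Icc 0 1) := by
    refine antitoneOn_of_deriv_nonpos (convex_Icc 0 1)
      (fun s _ => (hφ s).continuousAt.continuousWithinAt)
      (fun s _ => (hφ s).differentiableAt.differentiableWithinAt) fun s hs => ?_
    rw [interior_Icc] at hs
    rw [(hφ s).deriv, ← inner_sub_left]
    have h1 := real_inner_le_norm (h' (x + s • d) - h' x) d
    have h2 := hL (x + s • d) x
    rw [add_sub_cancel_left, norm_smul, Real.norm_of_nonneg hs.1.le] at h2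
    nlinarith [mul_le_mul_of_nonneg_right h2 (norm_nonneg d)]
  have h01 := hanti (Set.left_mem_Icc.2 zero_le_one) (Set.right_mem_Icc.2 zero_le_one) zero_le_one
  simp only [φ, one_smul, zero_smul, add_zero, hdd, add_sub_cancel] at h01
  simp only [hdd]
  linarith

/-- The contribution of one block of variables to the decrease of the objective in one round:
`a` is the gradient at the start, `b k` the gradients along the local steps, `N` the noise. -/
lemma inner_step_add_sq_le (a N : E) (b : ℕ → E) (K : ℕ) {γ L : ℝ} (hγ : 0 ≤ γ)
    (hL : 0 ≤ L) (h : 4 * L * K * γ ≤ 1) :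
    inner ℝ a (-(γ • (∑ k ∈ Finset.range K, b k + N))) +
        L * ‖-(γ • (∑ k ∈ Finset.range K, b k + N))‖ ^ 2 ≤
      -γ * inner ℝ a N - γ * K / 2 * ‖a‖ ^ 2 +
        γ / 2 * ∑ k ∈ Finset.range K, ‖a - b k‖ ^ 2 + 2 * L * γ ^ 2 * ‖N‖ ^ 2 := by
  have h1 : ∑ k ∈ Finset.range K, ‖a - b k‖ ^ 2 =
      K * ‖a‖ ^ 2 - 2 * ∑ k ∈ Finset.range K, inner ℝ a (b k) +
        ∑ k ∈ Finset.range K, ‖b k‖ ^ 2 := by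
    simp only [norm_sub_sq_real, Finset.sum_add_distrib, Finset.sum_sub_distrib, Finset.mul_sum]
    simp
  have h2 := norm_add_sq_le_two_mul (∑ k ∈ Finset.range K, b k) N
  have h3 := norm_sum_sq_le_card_mul (Finset.range K) b
  rw [Finset.card_range] at h3
  rw [norm_neg, norm_smul, mul_pow, Real.norm_of_nonneg hγ, inner_neg_right, inner_smul_right,
    inner_add_right, inner_sum, h1]
  set B := ∑ k ∈ Finset.range K, ‖b k‖ ^ 2
  have hB : 0 ≤ B := Finset.sum_nonneg fun _ _ => by positivity
  have h4 : L * (γ ^ 2 * ‖∑ k ∈ Finset.range K, b k + N‖ ^ 2) ≤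
      L * (γ ^ 2 * (2 * (K * B) + 2 * ‖N‖ ^ 2)) := by
    gcongr; linarith
  -- Expanding `‖a - b k‖ ^ 2` produces a spare `-γ / 2 * B`; the step condition lets it absorb the
  -- term `2 * L * K * γ ^ 2 * B` of the squared step.
  have h5 : (4 * L * K * γ) * (γ * B) ≤ 1 * (γ * B) := by gcongr
  nlinarith

/-- Displacement after at most `K` gradient steps `b j` with noise `e j` and step size `c`. -/
lemma norm_displacement_sq_le {δ b e : ℕ → E} {c : ℝ} (h0 : δ 0 = 0)
    (hs : ∀ k, δ (k + 1) = δ k - c • (b k + e k)) {k K : ℕ} (hk : k ≤ K) :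
    ‖δ k‖ ^ 2 ≤ 2 * (c ^ 2 * ‖∑ j ∈ Finset.range k, e j‖ ^ 2) +
      2 * c ^ 2 * K * ∑ j ∈ Finset.range K, ‖b j‖ ^ 2 := by
  -- The noise stays inside one norm, so that orthogonality can be used later; only the gradients
  -- are split by Cauchy–Schwarz.
  have h : δ k = -(c • (∑ j ∈ Finset.range k, e j + ∑ j ∈ Finset.range k, b j)) := by
    clear hk
    induction k with
    | zero => simp [h0]
    | succ k ih =>
      rw [hs, ih, Finset.sum_range_succ, Finset.sum_range_succ]
      module
  have h1 := norm_add_sq_le_two_mul (∑ j ∈ Finset.range k, e j) (∑ j ∈ Finset.range k, b j)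
  have h2 := norm_sum_sq_le_card_mul (Finset.range k) b
  have h3 : ((Finset.range k).card : ℝ) * ∑ j ∈ Finset.range k, ‖b j‖ ^ 2 ≤
      K * ∑ j ∈ Finset.range K, ‖b j‖ ^ 2 := by
    rw [Finset.card_range]
    gcongr
  rw [h, norm_neg, norm_smul, mul_pow, Real.norm_eq_abs, sq_abs]
  have h4 := mul_le_mul_of_nonneg_left (h1.trans (add_le_add_right
    (mul_le_mul_of_nonneg_left (h2.trans h3) zero_le_two) _)) (sq_nonneg c)
  linarith

end Hilbert

/-! ### Descent in two blocks of variables, and the drift of one client. -/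

section Round

variable {U V : Type*} [NormedAddCommGroup U] [InnerProductSpace ℝ U]
  [NormedAddCommGroup V] [InnerProductSpace ℝ V]

/-- Descent in both variables, for partial gradients that are `L`-Lipschitz in each variable. -/
lemma le_add_inner_partial_gradients_add_sq [CompleteSpace U] [CompleteSpace V]
    {f : U → V → ℝ} {Gu : U → V → U} {Gv : U → V → V} {L : ℝ}
    (hu : ∀ u v, HasGradientAt (fun u' => f u' v) (Gu u v) u)
    (hv : ∀ u v, HasGradientAt (fun v' => f u v') (Gv u v) v)
    (huu : ∀ u u' v, ‖Gu u v - Gu u' v‖ ≤ L * ‖u - u'‖)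
    (hvv : ∀ u v v', ‖Gv u v - Gv u v'‖ ≤ L * ‖v - v'‖)
    (hvu : ∀ u u' v, ‖Gv u v - Gv u' v‖ ≤ L * ‖u - u'‖) (hL : 0 ≤ L) (u u' : U) (v v' : V) :
    f u' v' ≤ f u v + inner ℝ (Gu u v) (u' - u) + inner ℝ (Gv u v) (v' - v) +
      L * ‖u' - u‖ ^ 2 + L * ‖v' - v‖ ^ 2 := by
  have h1 := le_add_inner_gradient_add_sq (fun x => hu x v) (fun x y => huu x y v) u u'
  have h2 := le_add_inner_gradient_add_sq (hv u') (hvv u') v v'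
  -- The `v`-step is expanded at the moved point `u'`. Returning its gradient to `u` costs a cross
  -- term, which Young's inequality splits evenly and which raises both coefficients from `L / 2` to
  -- `L`.
  have h3 : inner ℝ (Gv u' v) (v' - v) - inner ℝ (Gv u v) (v' - v) ≤
      L * ‖u' - u‖ * ‖v' - v‖ := by
    rw [← inner_sub_left]
    exact (real_inner_le_norm _ _).trans (by gcongr; exact hvu u' u v)
  nlinarith [mul_nonneg hL (sq_nonneg (‖u' - u‖ - ‖v' - v‖))]

omit [InnerProductSpace ℝ U] [InnerProductSpace ℝ V] in
lemma sum_norm_sq_le_of_lipschitz {E : Type*} [NormedAddCommGroup E] {G : U → V → E} {L : ℝ}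
    (hG : ∀ u v u' v', ‖G u v - G u' v'‖ ^ 2 ≤ 2 * L ^ 2 * (‖u - u'‖ ^ 2 + ‖v - v'‖ ^ 2))
    (x : U) (y : V) (qu : ℕ → U) (qv : ℕ → V) (K : ℕ) :
    ∑ k ∈ Finset.range K, ‖G (qu k) (qv k)‖ ^ 2 ≤ 2 * K * ‖G x y‖ ^ 2 +
      4 * L ^ 2 * ∑ k ∈ Finset.range K, (‖qu k - x‖ ^ 2 + ‖qv k - y‖ ^ 2) := by
  have : ∀ k ∈ Finset.range K, ‖G (qu k) (qv k)‖ ^ 2 ≤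
      2 * ‖G x y‖ ^ 2 + 4 * L ^ 2 * (‖qu k - x‖ ^ 2 + ‖qv k - y‖ ^ 2) := fun k _ => by
    have h1 := norm_add_sq_le_two_mul (G x y) (G (qu k) (qv k) - G x y)
    rw [add_sub_cancel] at h1
    linarith [hG (qu k) (qv k) x y]
  refine (Finset.sum_le_sum this).trans (le_of_eq ?_)
  rw [Finset.sum_add_distrib, Finset.mul_sum]
  simp; ring

/-- The drift of one client during one round. -/
lemma client_drift_le {Gu : U → V → U} {Gv : U → V → V} {L γ γu γv : ℝ} {K : ℕ}
    (hGu : ∀ u v u' v', ‖Gu u v - Gu u' v'‖ ^ 2 ≤ 2 * L ^ 2 * (‖u - u'‖ ^ 2 + ‖v - v'‖ ^ 2))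
    (hGv : ∀ u v u' v', ‖Gv u v - Gv u' v'‖ ^ 2 ≤ 2 * L ^ 2 * (‖u - u'‖ ^ 2 + ‖v - v'‖ ^ 2))
    (hu : γu ^ 2 ≤ γ ^ 2) (hv : γv ^ 2 ≤ γ ^ 2)
    (hx : (L * K * γ) ^ 2 ≤ 1 / 7056) {x : U} {y : V} {qu eu : ℕ → U} {qv ev : ℕ → V}
    (hqu0 : qu 0 = x) (hqv0 : qv 0 = y)
    (hqu : ∀ k, qu (k + 1) = qu k - γu • (Gu (qu k) (qv k) + eu k))
    (hqv : ∀ k, qv (k + 1) = qv k - γv • (Gv (qu k) (qv k) + ev k)) :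
    ∑ k ∈ Finset.range K, (‖qu k - x‖ ^ 2 + ‖qv k - y‖ ^ 2) ≤
      3 * ∑ k ∈ Finset.range K, (γu ^ 2 * ‖∑ j ∈ Finset.range k, eu j‖ ^ 2 +
          γv ^ 2 * ‖∑ j ∈ Finset.range k, ev j‖ ^ 2) +
        5 * K ^ 3 * (γu ^ 2 * ‖Gu x y‖ ^ 2 + γv ^ 2 * ‖Gv x y‖ ^ 2) := by
  set S := ∑ k ∈ Finset.range K, (‖qu k - x‖ ^ 2 + ‖qv k - y‖ ^ 2) with hS
  set M := ∑ k ∈ Finset.range K, (γu ^ 2 * ‖∑ j ∈ Finset.range k, eu j‖ ^ 2 +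
          γv ^ 2 * ‖∑ j ∈ Finset.range k, ev j‖ ^ 2) with hM
  set Bu := ∑ k ∈ Finset.range K, ‖Gu (qu k) (qv k)‖ ^ 2 with hBu
  set Bv := ∑ k ∈ Finset.range K, ‖Gv (qu k) (qv k)‖ ^ 2 with hBv
  have hS0 : 0 ≤ S := Finset.sum_nonneg fun _ _ => by positivity
  have hM0 : 0 ≤ M := Finset.sum_nonneg fun _ _ => by positivity
  have hbu : Bu ≤ 2 * K * ‖Gu x y‖ ^ 2 + 4 * L ^ 2 * S :=
    sum_norm_sq_le_of_lipschitz hGu x y qu qv K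
  have hbv : Bv ≤ 2 * K * ‖Gv x y‖ ^ 2 + 4 * L ^ 2 * S :=
    sum_norm_sq_le_of_lipschitz hGv x y qu qv K
  have h1 : S ≤ 2 * M + 2 * K ^ 2 * (γu ^ 2 * Bu + γv ^ 2 * Bv) := by
    have : ∀ k ∈ Finset.range K, ‖qu k - x‖ ^ 2 + ‖qv k - y‖ ^ 2 ≤
        2 * (γu ^ 2 * ‖∑ j ∈ Finset.range k, eu j‖ ^ 2 +
          γv ^ 2 * ‖∑ j ∈ Finset.range k, ev j‖ ^ 2) +
          2 * K * (γu ^ 2 * Bu + γv ^ 2 * Bv) := fun k hk => by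
      have hk' := (Finset.mem_range.1 hk).le
      have h1 := norm_displacement_sq_le (δ := fun k => qu k - x) (b := fun k => Gu (qu k) (qv k))
        (e := eu) (c := γu) (by simp [hqu0]) (fun k => by rw [hqu]; abel) hk'
      have h2 := norm_displacement_sq_le (δ := fun k => qv k - y) (b := fun k => Gv (qu k) (qv k))
        (e := ev) (c := γv) (by simp [hqv0]) (fun k => by rw [hqv]; abel) hk'
      linarith
    refine (Finset.sum_le_sum this).trans (le_of_eq ?_)
    rw [Finset.sum_add_distrib, ← Finset.mul_sum, ← hM]
    simp; ring
  have h2 : S ≤ 2 * M + 4 * K ^ 3 * (γu ^ 2 * ‖Gu x y‖ ^ 2 + γv ^ 2 * ‖Gv x y‖ ^ 2) +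
      8 * (L ^ 2 * K ^ 2 * (γu ^ 2 + γv ^ 2)) * S := by
    have hu' := mul_le_mul_of_nonneg_left hbu (sq_nonneg γu)
    have hv' := mul_le_mul_of_nonneg_left hbv (sq_nonneg γv)
    have := mul_le_mul_of_nonneg_left (add_le_add hu' hv') (by positivity : (0 : ℝ) ≤ 2 * K ^ 2)
    linarith
  -- The drift on the right now has coefficient at most `16 / 7056`; absorbing it on the left turns
  -- the constants 2 and 4 into 3 and 5.
  have h3 : L ^ 2 * K ^ 2 * (γu ^ 2 + γv ^ 2) * S ≤ 2 / 7056 * S := by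
    refine mul_le_mul_of_nonneg_right ?_ hS0
    have : L ^ 2 * K ^ 2 * (γu ^ 2 + γv ^ 2) ≤ L ^ 2 * K ^ 2 * (γ ^ 2 + γ ^ 2) := by gcongr
    linarith
  have h4 : 0 ≤ (K : ℝ) ^ 3 * (γu ^ 2 * ‖Gu x y‖ ^ 2 + γv ^ 2 * ‖Gv x y‖ ^ 2) := by positivity
  linarith

end Round

/-! ### Closing the loop between drift, displacement and client gradients. -/

/-- Summation over the rounds: `φ` is the objective, `G` the squared gradients, `S` the drift,
`P` the squared displacement of a round, `A` the squared client gradients, and `M`, `W`, `Λ`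
are noise terms. -/
lemma sum_rounds_le {T : ℕ} {K γ γu L B F0 : ℝ} {φ G S M W A P Λ : ℕ → ℝ} (hK : 1 ≤ K)
    (hγ : 0 < γ) (hL : 0 ≤ L) (hF0 : 0 ≤ F0) (hx : L * K * γ ≤ 1 / 84)
    (hG : ∀ t, 0 ≤ G t) (hS : ∀ t, 0 ≤ S t) (hM : ∀ t, 0 ≤ M t) (hW : ∀ t, 0 ≤ W t)
    (hP : ∀ t, 0 ≤ P t)
    (hφ : ∀ t < T, φ (t + 1) ≤ φ t - γ * K / 2 * G t + 2 * γ * L ^ 2 * S t +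
      2 * L * γ ^ 2 * W t - γ * Λ t)
    (hSt : ∀ t < T, S t ≤ 3 * M t + 5 * K ^ 3 * (γu ^ 2 * A t + γ ^ 2 * G t))
    (hPt : ∀ t < T, P t ≤ 2 * γ ^ 2 * W t + 4 * γ ^ 2 * K ^ 2 * G t +
      16 * γ ^ 2 * K * L ^ 2 * S t)
    (hAt : ∀ t < T, A t ≤ 2 * B + 4 * L ^ 2 * T * ∑ s ∈ Finset.range T, P s)
    (hγu : γu ^ 2 * T ^ 2 ≤ γ ^ 2) (hB : γu ^ 2 * (B * T) ≤ γ ^ 2 * (L * F0))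
    (hφT : φ 0 - F0 ≤ φ T) :
    γ * K / 4 * ∑ t ∈ Finset.range T, G t ≤ F0 + γ * K / 4 * (L * F0) +
      8 * γ * L ^ 2 * ∑ t ∈ Finset.range T, M t + 3 * L * γ ^ 2 * ∑ t ∈ Finset.range T, W t -
      γ * ∑ t ∈ Finset.range T, Λ t := by
  set sG := ∑ t ∈ Finset.range T, G t
  set sS := ∑ t ∈ Finset.range T, S t
  set sM := ∑ t ∈ Finset.range T, M t
  set sW := ∑ t ∈ Finset.range T, W t
  set sA := ∑ t ∈ Finset.range T, A t
  set sP := ∑ t ∈ Finset.range T, P t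
  set sΛ := ∑ t ∈ Finset.range T, Λ t
  have sG0 : 0 ≤ sG := Finset.sum_nonneg fun _ _ => hG _
  have sS0 : 0 ≤ sS := Finset.sum_nonneg fun _ _ => hS _
  have sM0 : 0 ≤ sM := Finset.sum_nonneg fun _ _ => hM _
  have sW0 : 0 ≤ sW := Finset.sum_nonneg fun _ _ => hW _
  have sP0 : 0 ≤ sP := Finset.sum_nonneg fun _ _ => hP _
  have hK0 : 0 < K := by linarith
  have eφ : φ T ≤ φ 0 - γ * K / 2 * sG + 2 * γ * L ^ 2 * sS + 2 * L * γ ^ 2 * sW - γ * sΛ := by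
    have h := Finset.sum_le_sum fun t ht =>
      sub_le_iff_le_add'.2 ((hφ t (Finset.mem_range.1 ht)).trans_eq (by ring :
        _ = φ t + (- (γ * K / 2) * G t + 2 * γ * L ^ 2 * S t + 2 * L * γ ^ 2 * W t + -γ * Λ t)))
    rw [Finset.sum_range_sub] at h
    simp only [Finset.sum_add_distrib, ← Finset.mul_sum] at h
    linarith
  have eS : sS ≤ 3 * sM + 5 * K ^ 3 * (γu ^ 2 * sA + γ ^ 2 * sG) := by
    have h := Finset.sum_le_sum fun t ht => hSt t (Finset.mem_range.1 ht)
    simpa only [Finset.sum_add_distrib, ← Finset.mul_sum] using h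
  have eP : sP ≤ 2 * γ ^ 2 * sW + 4 * γ ^ 2 * K ^ 2 * sG + 16 * γ ^ 2 * K * L ^ 2 * sS := by
    have h := Finset.sum_le_sum fun t ht => hPt t (Finset.mem_range.1 ht)
    simpa only [Finset.sum_add_distrib, ← Finset.mul_sum] using h
  have eA : sA ≤ T * (2 * B + 4 * L ^ 2 * T * sP) := by
    have h := Finset.sum_le_sum fun t ht => hAt t (Finset.mem_range.1 ht)
    simpa only [Finset.sum_const, Finset.card_range, nsmul_eq_mul] using h
  -- Here the lower bounds on `ηu` act: `hγu` cancels the factor `T ^ 2` in front of the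
  -- displacement and `hB` the factor `T` in front of the initial gradients.
  have e1 : γu ^ 2 * sA ≤ γ ^ 2 * (2 * (L * F0) + 4 * (L ^ 2 * sP)) := by
    have h1 := mul_le_mul_of_nonneg_left eA (sq_nonneg γu)
    have h2 := mul_le_mul_of_nonneg_right hγu (by positivity : 0 ≤ L ^ 2 * sP)
    linarith
  set c := (L * K * γ) ^ 2 with hc
  have hx0 : 0 ≤ L * K * γ := by positivity
  have hc0 : 0 ≤ c := by positivity
  have hc1 : c ≤ 1 / 7056 := by
    calc c ≤ (1 / 84) ^ 2 := pow_le_pow_left₀ hx0 hx 2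
      _ = _ := by norm_num
  set Y := L ^ 2 * sS with hY
  have hY0 : 0 ≤ Y := by positivity
  have e2 : Y ≤ 3 * (L ^ 2 * sM) + 5 * (K * c) * (2 * (L * F0) + 4 * (L ^ 2 * sP) + sG) := by
    have h1 := mul_le_mul_of_nonneg_left e1 (by positivity : 0 ≤ L ^ 2 * (5 * K ^ 3))
    have h2 := mul_le_mul_of_nonneg_left eS (sq_nonneg L)
    have : K * c = L ^ 2 * K ^ 3 * γ ^ 2 := by rw [hc]; ring
    rw [this]
    linarith
  -- The displacement brings the drift `Y` back, but with two further factors `c ≤ 1 / 84 ^ 2`, so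
  -- `e4` can absorb it.
  have e3 : K * c * (L ^ 2 * sP) ≤ 2 * (K * c * (L ^ 2 * γ ^ 2 * sW)) +
      4 * (1 / 7056 * (K * c * sG)) + 16 * (1 / 7056 * (1 / 7056 * Y)) := by
    have h1 := mul_le_mul_of_nonneg_left eP (by positivity : 0 ≤ K * c * L ^ 2)
    have h2 := mul_le_mul_of_nonneg_right hc1 (by positivity : 0 ≤ K * c * sG)
    have h3 : c * (c * Y) ≤ 1 / 7056 * (1 / 7056 * Y) := by gcongr
    have h4 : K * c * L ^ 2 * (4 * γ ^ 2 * K ^ 2 * sG) = 4 * (c * (K * c * sG)) := by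
      rw [hc]; ring
    have h5 : K * c * L ^ 2 * (16 * γ ^ 2 * K * L ^ 2 * sS) = 16 * (c * (c * Y)) := by
      rw [hc, hY]; ring
    linarith
  have p1 : 0 ≤ K * c * (L * F0) := by positivity
  have p2 : 0 ≤ K * c * sG := by positivity
  have p3 : 0 ≤ K * c * (L ^ 2 * γ ^ 2 * sW) := by positivity
  have p4 : 0 ≤ L ^ 2 * sM := by positivity
  have e4 : Y ≤ 4 * (L ^ 2 * sM) + 11 * (K * c * (L * F0)) + 6 * (K * c * sG) +
      41 * (K * c * (L ^ 2 * γ ^ 2 * sW)) := by linarith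
  have e5 : γ * (K * c * (L * F0)) ≤ 1 / 7056 * (γ * K * (L * F0)) := by
    have := mul_le_mul_of_nonneg_right hc1 (by positivity : 0 ≤ γ * K * (L * F0))
    linarith
  have e6 : γ * (K * c * sG) ≤ 1 / 7056 * (γ * K * sG) := by
    have := mul_le_mul_of_nonneg_right hc1 (by positivity : 0 ≤ γ * K * sG)
    linarith
  have e7 : γ * (K * c * (L ^ 2 * γ ^ 2 * sW)) ≤ 1 / 7056 * (1 / 84 * (L * γ ^ 2 * sW)) := by
    have : γ * (K * c * (L ^ 2 * γ ^ 2 * sW)) = c * ((L * K * γ) * (L * γ ^ 2 * sW)) := by ring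
    rw [this]
    gcongr
  have e8 := mul_le_mul_of_nonneg_left e4 hγ.le
  have p5 : 0 ≤ γ * K * (L * F0) := by positivity
  have p6 : 0 ≤ γ * K * sG := by positivity
  have p7 : 0 ≤ L * γ ^ 2 * sW := by positivity
  have e9 : 2 * γ * L ^ 2 * sS = 2 * (γ * Y) := by rw [hY]; ring
  linarith

/-- Needed for the displacement of a round: the gradients along the local steps are replaced by the
one at the start plus their deviation, with no condition on the step size. -/
lemma norm_step_sq_le {E : Type*} [NormedAddCommGroup E] [InnerProductSpace ℝ E] (a N : E)
    (b : ℕ → E) (K : ℕ) (γ : ℝ) :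
    ‖-(γ • (∑ k ∈ Finset.range K, b k + N))‖ ^ 2 ≤ 2 * γ ^ 2 * ‖N‖ ^ 2 +
      4 * γ ^ 2 * (K : ℝ) ^ 2 * ‖a‖ ^ 2 +
      4 * γ ^ 2 * K * ∑ k ∈ Finset.range K, ‖a - b k‖ ^ 2 := by
  have h1 := norm_add_sq_le_two_mul (∑ k ∈ Finset.range K, b k) N
  have h2 := norm_sum_sq_le_card_mul (Finset.range K) b
  have h3 : ∑ k ∈ Finset.range K, ‖b k‖ ^ 2 ≤
      2 * K * ‖a‖ ^ 2 + 2 * ∑ k ∈ Finset.range K, ‖a - b k‖ ^ 2 := by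
    have : ∀ k ∈ Finset.range K, ‖b k‖ ^ 2 ≤ 2 * ‖a‖ ^ 2 + 2 * ‖a - b k‖ ^ 2 := fun k _ => by
      have := norm_add_sq_le_two_mul a (-(a - b k))
      rwa [← sub_eq_add_neg, sub_sub_cancel, norm_neg] at this
    refine (Finset.sum_le_sum this).trans (le_of_eq ?_)
    rw [Finset.sum_add_distrib, Finset.mul_sum]
    simp; ring
  rw [Finset.card_range] at h2
  rw [norm_neg, norm_smul, mul_pow, Real.norm_eq_abs, sq_abs]
  have h4 := mul_le_mul_of_nonneg_left h1 (sq_nonneg γ)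
  have h5 := mul_le_mul_of_nonneg_left h2 (by positivity : 0 ≤ 2 * γ ^ 2)
  have h6 := mul_le_mul_of_nonneg_left h3 (by positivity : 0 ≤ 2 * γ ^ 2 * K)
  linarith

/-! ### Pathwise analysis of a noisy round and of a whole trajectory. -/

section Round

variable {U V : Type*} [NormedAddCommGroup U] [InnerProductSpace ℝ U]
  [NormedAddCommGroup V] [InnerProductSpace ℝ V] {n : ℕ}

/-- Mean squared drift of the local iterates during a round started at `(x, y)`. -/
def meanDrift (K : ℕ) (x : U) (y : Fin n → V) (qu : Fin n → ℕ → U) (qv : Fin n → ℕ → V) : ℝ :=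
  (1 / (n : ℝ)) * ∑ i, ∑ k ∈ Finset.range K, (‖qu i k - x‖ ^ 2 + ‖qv i k - y i‖ ^ 2)

/-- Squared norm of the gradient of the global objective, in the two groups of variables. -/
def gradSq (Gu : Fin n → U → V → U) (Gv : Fin n → U → V → V) (x : U) (y : Fin n → V) : ℝ :=
  ‖(1 / (n : ℝ)) • ∑ i, Gu i x (y i)‖ ^ 2 + (1 / (n : ℝ)) * ∑ i, ‖Gv i x (y i)‖ ^ 2

/-- Mean of the squared client gradients in the shared variable. -/
def meanGradSq (Gu : Fin n → U → V → U) (x : U) (y : Fin n → V) : ℝ :=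
  (1 / (n : ℝ)) * ∑ i, ‖Gu i x (y i)‖ ^ 2

/-- Mean squared displacement. -/
def dispSq (x : U) (y : Fin n → V) (x' : U) (y' : Fin n → V) : ℝ :=
  ‖x' - x‖ ^ 2 + (1 / (n : ℝ)) * ∑ i, ‖y' i - y i‖ ^ 2

/-- Squared norms of the accumulated noise of a whole round. -/
def noiseSq (K : ℕ) (eu : Fin n → ℕ → U) (ev : Fin n → ℕ → V) : ℝ :=
  ‖(1 / (n : ℝ)) • ∑ i, ∑ k ∈ Finset.range K, eu i k‖ ^ 2 +
    (1 / (n : ℝ)) * ∑ i, ‖∑ k ∈ Finset.range K, ev i k‖ ^ 2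

/-- Weighted squared norms of the noise accumulated by the clients before each local step. -/
def localNoiseSq (K : ℕ) (γu γv : ℝ) (eu : Fin n → ℕ → U) (ev : Fin n → ℕ → V) : ℝ :=
  (1 / (n : ℝ)) * ∑ i, ∑ k ∈ Finset.range K, (γu ^ 2 * ‖∑ j ∈ Finset.range k, eu i j‖ ^ 2 +
    γv ^ 2 * ‖∑ j ∈ Finset.range k, ev i j‖ ^ 2)

/-- Inner product of the gradient of the global objective with the noise of a round. -/
def noiseInner (Gu : Fin n → U → V → U) (Gv : Fin n → U → V → V) (K : ℕ) (x : U)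
    (y : Fin n → V) (eu : Fin n → ℕ → U) (ev : Fin n → ℕ → V) : ℝ :=
  inner ℝ ((1 / (n : ℝ)) • ∑ i, Gu i x (y i))
      ((1 / (n : ℝ)) • ∑ i, ∑ k ∈ Finset.range K, eu i k) +
    (1 / (n : ℝ)) * ∑ i, inner ℝ (Gv i x (y i)) (∑ k ∈ Finset.range K, ev i k)

/-- One round of gradient steps with noise `eu`, `ev`, from `(x, y)` to `(x', y')`. -/
structure NoisyRound (Gu : Fin n → U → V → U) (Gv : Fin n → U → V → V) (K : ℕ) (γ γu γv : ℝ)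
    (x : U) (y : Fin n → V) (qu eu : Fin n → ℕ → U) (qv ev : Fin n → ℕ → V)
    (x' : U) (y' : Fin n → V) : Prop where
  qu_zero : ∀ i, qu i 0 = x
  qv_zero : ∀ i, qv i 0 = y i
  qu_succ : ∀ i k, qu i (k + 1) = qu i k - γu • (Gu i (qu i k) (qv i k) + eu i k)
  qv_succ : ∀ i k, qv i (k + 1) = qv i k - γv • (Gv i (qu i k) (qv i k) + ev i k)
  x_eq : x' = x - γ • ((1 / (n : ℝ)) •
    ∑ i, ∑ k ∈ Finset.range K, (Gu i (qu i k) (qv i k) + eu i k))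
  y_eq : ∀ i, y' i = y i - γ • ∑ k ∈ Finset.range K, (Gv i (qu i k) (qv i k) + ev i k)

/-- Regularity of the client objectives `f i` with partial gradients `Gu i`, `Gv i`. -/
structure LipschitzGrads (f : Fin n → U → V → ℝ) [CompleteSpace U] [CompleteSpace V]
    (Gu : Fin n → U → V → U) (Gv : Fin n → U → V → V) (L : ℝ) : Prop where
  nonneg : 0 ≤ L
  hasGrad_u : ∀ i u v, HasGradientAt (fun u' => f i u' v) (Gu i u v) u
  hasGrad_v : ∀ i u v, HasGradientAt (fun v' => f i u v') (Gv i u v) v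
  lip_uu : ∀ i u u' v, ‖Gu i u v - Gu i u' v‖ ≤ L * ‖u - u'‖
  lip_uv : ∀ i u v v', ‖Gu i u v - Gu i u v'‖ ≤ L * ‖v - v'‖
  lip_vv : ∀ i u v v', ‖Gv i u v - Gv i u v'‖ ≤ L * ‖v - v'‖
  lip_vu : ∀ i u u' v, ‖Gv i u v - Gv i u' v‖ ≤ L * ‖u - u'‖

namespace LipschitzGrads

variable [CompleteSpace U] [CompleteSpace V] {f : Fin n → U → V → ℝ}
  {Gu : Fin n → U → V → U} {Gv : Fin n → U → V → V} {L : ℝ}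

lemma norm_sub_u_le (h : LipschitzGrads f Gu Gv L) (i : Fin n) (u : U) (v : V) (u' : U) (v' : V) :
    ‖Gu i u v - Gu i u' v'‖ ≤ L * ‖u - u'‖ + L * ‖v - v'‖ := by
  have h1 := norm_sub_le_norm_sub_add_norm_sub (Gu i u v) (Gu i u' v) (Gu i u' v')
  linarith [h.lip_uu i u u' v, h.lip_uv i u' v v']

lemma norm_sub_v_le (h : LipschitzGrads f Gu Gv L) (i : Fin n) (u : U) (v : V) (u' : U) (v' : V) :
    ‖Gv i u v - Gv i u' v'‖ ≤ L * ‖u - u'‖ + L * ‖v - v'‖ := by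
  have h1 := norm_sub_le_norm_sub_add_norm_sub (Gv i u v) (Gv i u' v) (Gv i u' v')
  linarith [h.lip_vu i u u' v, h.lip_vv i u' v v']

lemma sq_le_of_le_add {a L p q : ℝ} (ha : 0 ≤ a) (h : a ≤ L * p + L * q) :
    a ^ 2 ≤ 2 * L ^ 2 * (p ^ 2 + q ^ 2) := by
  have := pow_le_pow_left₀ ha h 2
  nlinarith [sq_nonneg (L * p - L * q)]

lemma norm_sub_u_sq_le (h : LipschitzGrads f Gu Gv L) (i : Fin n) (u : U) (v : V) (u' : U)
    (v' : V) : ‖Gu i u v - Gu i u' v'‖ ^ 2 ≤ 2 * L ^ 2 * (‖u - u'‖ ^ 2 + ‖v - v'‖ ^ 2) :=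
  sq_le_of_le_add (norm_nonneg _) (h.norm_sub_u_le i u v u' v')

lemma norm_sub_v_sq_le (h : LipschitzGrads f Gu Gv L) (i : Fin n) (u : U) (v : V) (u' : U)
    (v' : V) : ‖Gv i u v - Gv i u' v'‖ ^ 2 ≤ 2 * L ^ 2 * (‖u - u'‖ ^ 2 + ‖v - v'‖ ^ 2) :=
  sq_le_of_le_add (norm_nonneg _) (h.norm_sub_v_le i u v u' v')

end LipschitzGrads

namespace NoisyRound

variable [CompleteSpace U] [CompleteSpace V] {f : Fin n → U → V → ℝ}
  {Gu : Fin n → U → V → U} {Gv : Fin n → U → V → V} {L γ γu γv : ℝ} {K : ℕ}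
  {x x' : U} {y y' : Fin n → V} {qu eu : Fin n → ℕ → U} {qv ev : Fin n → ℕ → V}

/-- The two blocks are treated differently: the `v`-gradients are part of `gradSq`, so `γv` may be
enlarged to `γ`, whereas the individual `u`-gradients are not controlled by their average and must
keep the small weight `γu ^ 2`. -/
lemma meanDrift_le (hf : LipschitzGrads f Gu Gv L)
    (h : NoisyRound Gu Gv K γ γu γv x y qu eu qv ev x' y')
    (hu : γu ^ 2 ≤ γ ^ 2) (hv : γv ^ 2 ≤ γ ^ 2) (hx : (L * K * γ) ^ 2 ≤ 1 / 7056) :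
    meanDrift K x y qu qv ≤ 3 * localNoiseSq K γu γv eu ev +
      5 * (K : ℝ) ^ 3 * (γu ^ 2 * meanGradSq Gu x y + γ ^ 2 * gradSq Gu Gv x y) := by
  have h1 := Finset.sum_le_sum fun i (_ : i ∈ Finset.univ) =>
    client_drift_le (hf.norm_sub_u_sq_le i) (hf.norm_sub_v_sq_le i) hu hv hx (h.qu_zero i)
      (h.qv_zero i) (h.qu_succ i) (h.qv_succ i)
  have h2 := mul_le_mul_of_nonneg_left h1 (by positivity : 0 ≤ 1 / (n : ℝ))
  simp only [Finset.sum_add_distrib, ← Finset.mul_sum] at h2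
  have h3 : γv ^ 2 * ((1 / (n : ℝ)) * ∑ i, ‖Gv i x (y i)‖ ^ 2) ≤ γ ^ 2 * gradSq Gu Gv x y := by
    unfold gradSq
    gcongr
    exact le_add_of_nonneg_left (by positivity)
  have h4 := mul_le_mul_of_nonneg_left h3 (by positivity : 0 ≤ 5 * (K : ℝ) ^ 3)
  simp only [meanDrift, localNoiseSq, meanGradSq, Finset.sum_add_distrib, ← Finset.mul_sum]
  linarith

omit [CompleteSpace U] [CompleteSpace V] in
lemma sub_eq_u (h : NoisyRound Gu Gv K γ γu γv x y qu eu qv ev x' y') :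
    x' - x = -(γ • (∑ k ∈ Finset.range K, ((1 / (n : ℝ)) • ∑ i, Gu i (qu i k) (qv i k)) +
      (1 / (n : ℝ)) • ∑ i, ∑ k ∈ Finset.range K, eu i k)) := by
  rw [h.x_eq, ← Finset.smul_sum, Finset.sum_comm (s := Finset.range K)]
  simp only [Finset.sum_add_distrib, smul_add]
  abel

omit [CompleteSpace U] [CompleteSpace V] in
lemma sub_eq_v (h : NoisyRound Gu Gv K γ γu γv x y qu eu qv ev x' y') (i : Fin n) :
    y' i - y i = -(γ • (∑ k ∈ Finset.range K, Gv i (qu i k) (qv i k) +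
      ∑ k ∈ Finset.range K, ev i k)) := by
  rw [h.y_eq]
  simp only [Finset.sum_add_distrib, smul_add]
  abel

lemma sum_norm_avg_sub_sq_le (hn : 1 ≤ n) (hf : LipschitzGrads f Gu Gv L) :
    ∑ k ∈ Finset.range K, ‖(1 / (n : ℝ)) • ∑ i, Gu i x (y i) -
      (1 / (n : ℝ)) • ∑ i, Gu i (qu i k) (qv i k)‖ ^ 2 ≤ 2 * L ^ 2 * meanDrift K x y qu qv := by
  have h1 : ∀ k ∈ Finset.range K, ‖(1 / (n : ℝ)) • ∑ i, Gu i x (y i) -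
      (1 / (n : ℝ)) • ∑ i, Gu i (qu i k) (qv i k)‖ ^ 2 ≤
      (1 / (n : ℝ)) * ∑ i, 2 * L ^ 2 * (‖qu i k - x‖ ^ 2 + ‖qv i k - y i‖ ^ 2) := fun k _ => by
    rw [← smul_sub, ← Finset.sum_sub_distrib]
    refine (norm_average_sq_le hn _).trans ?_
    gcongr with i
    rw [norm_sub_rev]
    exact hf.norm_sub_u_sq_le i _ _ _ _
  refine (Finset.sum_le_sum h1).trans (le_of_eq ?_)
  rw [meanDrift, Finset.sum_comm (s := Finset.univ)]
  simp only [← Finset.mul_sum]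
  ring

lemma mean_sum_norm_sub_sq_le (hf : LipschitzGrads f Gu Gv L) :
    (1 / (n : ℝ)) * ∑ i, ∑ k ∈ Finset.range K, ‖Gv i x (y i) - Gv i (qu i k) (qv i k)‖ ^ 2 ≤
      2 * L ^ 2 * meanDrift K x y qu qv := by
  have h1 : ∑ i, ∑ k ∈ Finset.range K, ‖Gv i x (y i) - Gv i (qu i k) (qv i k)‖ ^ 2 ≤
      ∑ i, ∑ k ∈ Finset.range K, 2 * L ^ 2 * (‖qu i k - x‖ ^ 2 + ‖qv i k - y i‖ ^ 2) := by
    gcongr with i _ k _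
    rw [norm_sub_rev]
    exact hf.norm_sub_v_sq_le i _ _ _ _
  refine (mul_le_mul_of_nonneg_left h1 (by positivity)).trans (le_of_eq ?_)
  simp only [meanDrift, ← Finset.mul_sum]
  ring

/-- `inner_step_add_sq_le` is used once for the averaged `u`-gradient, so that the `u`-noise enters
averaged, and once per client for `v`. Each block contributes `γ / 2 * (2 * L ^ 2)` times the drift.
-/
lemma descent (hn : 1 ≤ n) (hf : LipschitzGrads f Gu Gv L)
    (h : NoisyRound Gu Gv K γ γu γv x y qu eu qv ev x' y') (hγ : 0 ≤ γ)
    (hx : 4 * L * K * γ ≤ 1) :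
    (1 / (n : ℝ)) * ∑ i, f i x' (y' i) ≤ (1 / (n : ℝ)) * ∑ i, f i x (y i) -
      γ * K / 2 * gradSq Gu Gv x y + 2 * γ * L ^ 2 * meanDrift K x y qu qv +
      2 * L * γ ^ 2 * noiseSq K eu ev - γ * noiseInner Gu Gv K x y eu ev := by
  have hn' : (n : ℝ) ≠ 0 := by positivity
  have h1 : (1 / (n : ℝ)) * ∑ i, f i x' (y' i) ≤ (1 / (n : ℝ)) * ∑ i, f i x (y i) +
      (inner ℝ ((1 / (n : ℝ)) • ∑ i, Gu i x (y i)) (x' - x) + L * ‖x' - x‖ ^ 2) +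
      (1 / (n : ℝ)) * ∑ i, (inner ℝ (Gv i x (y i)) (y' i - y i) + L * ‖y' i - y i‖ ^ 2) := by
    have h2 := Finset.sum_le_sum fun i (_ : i ∈ Finset.univ) =>
      le_add_inner_partial_gradients_add_sq (hf.hasGrad_u i) (hf.hasGrad_v i) (hf.lip_uu i)
        (hf.lip_vv i) (hf.lip_vu i) hf.nonneg x x' (y i) (y' i)
    have h3 := mul_le_mul_of_nonneg_left h2 (by positivity : 0 ≤ 1 / (n : ℝ))
    have h4 : (1 / (n : ℝ)) * (n * (L * ‖x' - x‖ ^ 2)) = L * ‖x' - x‖ ^ 2 := by field_simp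
    simp only [Finset.sum_add_distrib, Finset.sum_const, Finset.card_univ, Fintype.card_fin,
      nsmul_eq_mul, mul_add, h4] at h3
    simp only [Finset.sum_add_distrib, real_inner_smul_left, sum_inner, mul_add]
    linarith
  have hu := inner_step_add_sq_le ((1 / (n : ℝ)) • ∑ i, Gu i x (y i))
    ((1 / (n : ℝ)) • ∑ i, ∑ k ∈ Finset.range K, eu i k)
    (fun k => (1 / (n : ℝ)) • ∑ i, Gu i (qu i k) (qv i k)) K hγ hf.nonneg hx
  rw [← h.sub_eq_u] at hu
  have hv := Finset.sum_le_sum fun i (_ : i ∈ Finset.univ) =>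
    inner_step_add_sq_le (Gv i x (y i)) (∑ k ∈ Finset.range K, ev i k)
      (fun k => Gv i (qu i k) (qv i k)) K hγ hf.nonneg hx
  simp only [← h.sub_eq_v] at hv
  have hv' := mul_le_mul_of_nonneg_left hv (by positivity : 0 ≤ 1 / (n : ℝ))
  simp only [Finset.sum_add_distrib, Finset.sum_sub_distrib, ← Finset.mul_sum] at hv' h1
  have hdu := mul_le_mul_of_nonneg_left (sum_norm_avg_sub_sq_le (K := K) (x := x) (y := y)
    (qu := qu) (qv := qv) hn hf) (by positivity : 0 ≤ γ / 2)
  have hdv := mul_le_mul_of_nonneg_left (mean_sum_norm_sub_sq_le (K := K) (x := x) (y := y)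
    (qu := qu) (qv := qv) hf) (by positivity : 0 ≤ γ / 2)
  simp only [gradSq, noiseSq, noiseInner]
  linarith

lemma dispSq_le (hn : 1 ≤ n) (hf : LipschitzGrads f Gu Gv L)
    (h : NoisyRound Gu Gv K γ γu γv x y qu eu qv ev x' y') :
    dispSq x y x' y' ≤ 2 * γ ^ 2 * noiseSq K eu ev +
      4 * γ ^ 2 * (K : ℝ) ^ 2 * gradSq Gu Gv x y + 16 * γ ^ 2 * K * L ^ 2 * meanDrift K x y qu qv := by
  have hu := norm_step_sq_le ((1 / (n : ℝ)) • ∑ i, Gu i x (y i))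
    ((1 / (n : ℝ)) • ∑ i, ∑ k ∈ Finset.range K, eu i k)
    (fun k => (1 / (n : ℝ)) • ∑ i, Gu i (qu i k) (qv i k)) K γ
  rw [← h.sub_eq_u] at hu
  have hv := Finset.sum_le_sum fun i (_ : i ∈ Finset.univ) =>
    norm_step_sq_le (Gv i x (y i)) (∑ k ∈ Finset.range K, ev i k)
      (fun k => Gv i (qu i k) (qv i k)) K γ
  simp only [← h.sub_eq_v] at hv
  have hv' := mul_le_mul_of_nonneg_left hv (by positivity : 0 ≤ 1 / (n : ℝ))
  simp only [Finset.sum_add_distrib, ← Finset.mul_sum] at hv'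
  have hdu := mul_le_mul_of_nonneg_left (sum_norm_avg_sub_sq_le (K := K) (x := x) (y := y)
    (qu := qu) (qv := qv) hn hf) (by positivity : 0 ≤ 4 * γ ^ 2 * K)
  have hdv := mul_le_mul_of_nonneg_left (mean_sum_norm_sub_sq_le (K := K) (x := x) (y := y)
    (qu := qu) (qv := qv) hf) (by positivity : 0 ≤ 4 * γ ^ 2 * K)
  simp only [gradSq, noiseSq, dispSq]
  linarith

end NoisyRound

omit [InnerProductSpace ℝ U] in
lemma norm_sub_zero_sq_le (x : ℕ → U) {t T : ℕ} (ht : t ≤ T) :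
    ‖x t - x 0‖ ^ 2 ≤ T * ∑ s ∈ Finset.range T, ‖x (s + 1) - x s‖ ^ 2 := by
  rw [← Finset.sum_range_sub]
  refine (norm_sum_sq_le_card_mul _ _).trans ?_
  rw [Finset.card_range]
  gcongr

/-- This takes the place of a bounded-heterogeneity assumption. The gradients are Lipschitz, and by
Cauchy–Schwarz the squared distance to the start is at most `T` times the sum of the squared
displacements of the rounds. -/
lemma meanGradSq_le [CompleteSpace U] [CompleteSpace V] {f : Fin n → U → V → ℝ}
    {Gu : Fin n → U → V → U} {Gv : Fin n → U → V → V} {L : ℝ} (hn : 1 ≤ n)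
    (hf : LipschitzGrads f Gu Gv L) (x : ℕ → U) (y : ℕ → Fin n → V) {t T : ℕ} (ht : t ≤ T) :
    meanGradSq Gu (x t) (y t) ≤ 2 * meanGradSq Gu (x 0) (y 0) +
      4 * L ^ 2 * T * ∑ s ∈ Finset.range T, dispSq (x s) (y s) (x (s + 1)) (y (s + 1)) := by
  have h1 : ∀ i ∈ Finset.univ, ‖Gu i (x t) (y t i)‖ ^ 2 ≤ 2 * ‖Gu i (x 0) (y 0 i)‖ ^ 2 +
      4 * L ^ 2 * T * ((∑ s ∈ Finset.range T, ‖x (s + 1) - x s‖ ^ 2) +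
        ∑ s ∈ Finset.range T, ‖y (s + 1) i - y s i‖ ^ 2) := fun i _ => by
    have h2 := norm_add_sq_le_two_mul (Gu i (x 0) (y 0 i))
      (Gu i (x t) (y t i) - Gu i (x 0) (y 0 i))
    rw [add_sub_cancel] at h2
    have h3 := hf.norm_sub_u_sq_le i (x t) (y t i) (x 0) (y 0 i)
    have h4 := mul_le_mul_of_nonneg_left (add_le_add (norm_sub_zero_sq_le x ht)
      (norm_sub_zero_sq_le (fun t => y t i) ht)) (by positivity : 0 ≤ 4 * L ^ 2)
    linarith
  have h2 := mul_le_mul_of_nonneg_left (Finset.sum_le_sum h1) (by positivity : 0 ≤ 1 / (n : ℝ))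
  refine h2.trans (le_of_eq ?_)
  simp only [meanGradSq, dispSq, Finset.sum_add_distrib, ← Finset.mul_sum, Finset.sum_const,
    Finset.card_univ, Fintype.card_fin, nsmul_eq_mul]
  rw [Finset.sum_comm (s := Finset.range T)]
  field_simp

/-- The decrease of the objective along a noisy trajectory. -/
theorem sum_gradSq_le [CompleteSpace U] [CompleteSpace V] {f : Fin n → U → V → ℝ}
    {Gu : Fin n → U → V → U} {Gv : Fin n → U → V → V} {L γ γu γv F0 : ℝ} {K T : ℕ} (hn : 1 ≤ n)
    (hK : 1 ≤ K) (hf : LipschitzGrads f Gu Gv L) {x : ℕ → U} {y : ℕ → Fin n → V}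
    {qu eu : ℕ → Fin n → ℕ → U} {qv ev : ℕ → Fin n → ℕ → V}
    (h : ∀ t < T, NoisyRound Gu Gv K γ γu γv (x t) (y t) (qu t) (eu t) (qv t) (ev t)
      (x (t + 1)) (y (t + 1)))
    (hγ : 0 < γ) (hx : L * K * γ ≤ 1 / 84) (hF0 : 0 ≤ F0) (hu : γu ^ 2 ≤ γ ^ 2)
    (hv : γv ^ 2 ≤ γ ^ 2) (huT : γu ^ 2 * T ^ 2 ≤ γ ^ 2)
    (hB : γu ^ 2 * (meanGradSq Gu (x 0) (y 0) * T) ≤ γ ^ 2 * (L * F0))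
    (hfT : (1 / (n : ℝ)) * ∑ i, f i (x 0) (y 0 i) - F0 ≤ (1 / (n : ℝ)) * ∑ i, f i (x T) (y T i)) :
    γ * K / 4 * ∑ t ∈ Finset.range T, gradSq Gu Gv (x t) (y t) ≤ F0 + γ * K / 4 * (L * F0) +
      8 * γ * L ^ 2 * ∑ t ∈ Finset.range T, localNoiseSq K γu γv (eu t) (ev t) +
      3 * L * γ ^ 2 * ∑ t ∈ Finset.range T, noiseSq K (eu t) (ev t) -
      γ * ∑ t ∈ Finset.range T, noiseInner Gu Gv K (x t) (y t) (eu t) (ev t) := by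
  have hL := hf.nonneg
  have hx2 : (L * K * γ) ^ 2 ≤ 1 / 7056 :=
    (pow_le_pow_left₀ (by positivity) hx 2).trans (by norm_num)
  refine sum_rounds_le (φ := fun t => (1 / (n : ℝ)) * ∑ i, f i (x t) (y t i))
    (S := fun t => meanDrift K (x t) (y t) (qu t) (qv t))
    (P := fun t => dispSq (x t) (y t) (x (t + 1)) (y (t + 1)))
    (A := fun t => meanGradSq Gu (x t) (y t)) (B := meanGradSq Gu (x 0) (y 0))
    (by exact_mod_cast hK) hγ hL hF0 hx (fun t => ?_) (fun t => ?_) (fun t => ?_) (fun t => ?_)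
    (fun t => ?_) (fun t ht => (h t ht).descent hn hf hγ.le (by linarith))
    (fun t ht => (h t ht).meanDrift_le hf hu hv hx2)
    (fun t ht => (h t ht).dispSq_le hn hf)
    (fun t ht => meanGradSq_le hn hf x y ht.le) huT hB hfT
  · unfold gradSq; positivity
  · unfold meanDrift; positivity
  · unfold localNoiseSq; positivity
  · unfold noiseSq; positivity
  · unfold dispSq; positivity

end Round

/-! ### Second moments and orthogonality from independence. -/

section Noise

variable {Ω Ξ 𝒴 E : Type*} [MeasurableSpace Ω] [MeasurableSpace Ξ] {m𝒴 : MeasurableSpace 𝒴}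
  [NormedAddCommGroup E] [InnerProductSpace ℝ E] [MeasurableSpace E] [BorelSpace E]
  [SecondCountableTopology E] {P : Measure Ω} [IsProbabilityMeasure P] {D : Measure Ξ}
  [IsProbabilityMeasure D] {Y : Ω → 𝒴} {Z : Ω → Ξ} {g : 𝒴 → Ξ → E}

lemma map_prodMk_eq_of_indepFun (hY : Measurable Y) (hZ : Measurable Z) (hD : P.map Z = D)
    (hYZ : IndepFun Y Z P) : P.map (fun ω => (Y ω, Z ω)) = (P.map Y).prod D := by
  rw [(indepFun_iff_map_prod_eq_prod_map_map hY.aemeasurable hZ.aemeasurable).1 hYZ, hD]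

/-- By independence the joint law is a product, so Fubini allows `Y` to be frozen; the bound for
each fixed `y` is uniform. -/
lemma memLp_and_integral_norm_sq_le (hY : Measurable Y) (hZ : Measurable Z) (hD : P.map Z = D)
    (hYZ : IndepFun Y Z P) (hg : Measurable (Function.uncurry g)) {c : ℝ}
    (hint : ∀ y, Integrable (fun a => ‖g y a‖ ^ 2) D) (hc : ∀ y, ∫ a, ‖g y a‖ ^ 2 ∂D ≤ c) :
    MemLp (fun ω => g (Y ω) (Z ω)) 2 P ∧ ∫ ω, ‖g (Y ω) (Z ω)‖ ^ 2 ∂P ≤ c := by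
  have hYZm : Measurable fun ω => (Y ω, Z ω) := hY.prodMk hZ
  have hlaw := map_prodMk_eq_of_indepFun hY hZ hD hYZ
  have : IsProbabilityMeasure (P.map Y) := Measure.isProbabilityMeasure_map hY.aemeasurable
  have hm : Measurable fun p : 𝒴 × Ξ => ‖Function.uncurry g p‖ ^ 2 := hg.norm.pow_const 2
  have hI : Integrable (fun p : 𝒴 × Ξ => ‖Function.uncurry g p‖ ^ 2) ((P.map Y).prod D) := by
    refine (integrable_prod_iff hm.aestronglyMeasurable).2 ⟨.of_forall hint, ?_⟩
    refine Integrable.mono' (integrable_const c)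
      hm.norm.stronglyMeasurable.integral_prod_right'.aestronglyMeasurable
      (.of_forall fun y => ?_)
    rw [Real.norm_of_nonneg (integral_nonneg fun _ => norm_nonneg _)]
    simpa using hc y
  rw [← hlaw] at hI
  have hmap := integral_map hYZm.aemeasurable (hm.aestronglyMeasurable (μ := P.map _))
  refine ⟨(memLp_two_iff_integrable_sq_norm (hg.comp hYZm).aestronglyMeasurable).2
    (hI.comp_measurable hYZm), ?_⟩
  calc ∫ ω, ‖g (Y ω) (Z ω)‖ ^ 2 ∂P
      = ∫ p, ‖Function.uncurry g p‖ ^ 2 ∂(P.map fun ω => (Y ω, Z ω)) := hmap.symm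
    _ = ∫ y, ∫ a, ‖g y a‖ ^ 2 ∂D ∂(P.map Y) := by
        rw [hlaw] at hI ⊢
        exact integral_prod _ hI
    _ ≤ ∫ y, c ∂(P.map Y) := by
        refine integral_mono_of_nonneg (.of_forall fun y => integral_nonneg fun _ => by positivity)
          (integrable_const c) (.of_forall hc)
    _ = c := by simp

lemma integrable_inner_of_memLp {a b : Ω → E} (ha : MemLp a 2 P) (hb : MemLp b 2 P) :
    Integrable (fun ω => inner ℝ (a ω) (b ω)) P := by
  refine Integrable.mono' (ha.norm.integrable_mul hb.norm)
    (ha.aestronglyMeasurable.inner hb.aestronglyMeasurable) (.of_forall fun ω => ?_)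
  exact norm_inner_le_norm _ _

/-- Fubini again: for frozen `Y` the vector `h (Y ω)` is constant and the noise integrates to zero.
-/
lemma integral_inner_eq_zero_of_indepFun [CompleteSpace E] (hY : Measurable Y)
    (hZ : Measurable Z) (hD : P.map Z = D)
    (hYZ : IndepFun Y Z P) (hg : Measurable (Function.uncurry g))
    (hint : ∀ y, Integrable (g y) D) (hmean : ∀ y, ∫ a, g y a ∂D = 0) {h : 𝒴 → E}
    (hh : Measurable h) (hhL : MemLp (fun ω => h (Y ω)) 2 P)
    (hgL : MemLp (fun ω => g (Y ω) (Z ω)) 2 P) :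
    ∫ ω, inner ℝ (h (Y ω)) (g (Y ω) (Z ω)) ∂P = 0 := by
  have hYZm : Measurable fun ω => (Y ω, Z ω) := hY.prodMk hZ
  have hlaw := map_prodMk_eq_of_indepFun hY hZ hD hYZ
  have : IsProbabilityMeasure (P.map Y) := Measure.isProbabilityMeasure_map hY.aemeasurable
  have hm : Measurable fun p : 𝒴 × Ξ => (inner ℝ (h p.1) (Function.uncurry g p) : ℝ) :=
    (hh.comp measurable_fst).inner hg
  have hI : Integrable (fun p : 𝒴 × Ξ => (inner ℝ (h p.1) (Function.uncurry g p) : ℝ))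
      (P.map fun ω => (Y ω, Z ω)) :=
    (integrable_map_measure hm.aestronglyMeasurable hYZm.aemeasurable).2
      (integrable_inner_of_memLp hhL hgL)
  have hmap := integral_map hYZm.aemeasurable (hm.aestronglyMeasurable (μ := P.map _))
  refine hmap.symm.trans ?_
  rw [hlaw] at hI ⊢
  rw [integral_prod _ hI]
  simp only [Function.uncurry_apply_pair]
  simp_rw [integral_inner (hint _), hmean, inner_zero_right]
  simp

lemma integral_norm_sum_sq_le {ι : Type*} (s : Finset ι) {e : ι → Ω → E} {c : ℝ}
    (he : ∀ i ∈ s, MemLp (e i) 2 P)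
    (horth : ∀ i ∈ s, ∀ j ∈ s, i ≠ j → ∫ ω, inner ℝ (e i ω) (e j ω) ∂P = 0)
    (hc : ∀ i ∈ s, ∫ ω, ‖e i ω‖ ^ 2 ∂P ≤ c) :
    ∫ ω, ‖∑ i ∈ s, e i ω‖ ^ 2 ∂P ≤ s.card * c := by
  have h1 : ∀ ω, ‖∑ i ∈ s, e i ω‖ ^ 2 = ∑ i ∈ s, ∑ j ∈ s, inner ℝ (e i ω) (e j ω) := fun ω => by
    rw [← real_inner_self_eq_norm_sq, sum_inner]
    simp_rw [inner_sum]
  simp_rw [h1]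
  rw [integral_finsetSum _ fun i hi => integrable_finsetSum _ fun j hj =>
    integrable_inner_of_memLp (he i hi) (he j hj)]
  calc ∑ i ∈ s, ∫ ω, ∑ j ∈ s, inner ℝ (e i ω) (e j ω) ∂P ≤ ∑ i ∈ s, c := by
        refine Finset.sum_le_sum fun i hi => ?_
        rw [integral_finsetSum _ fun j hj => integrable_inner_of_memLp (he i hi) (he j hj),
          Finset.sum_eq_single_of_mem i hi fun j hj hji => horth i hi j hj hji.symm]
        simpa only [real_inner_self_eq_norm_sq] using hc i hi
    _ = s.card * c := by simp

end Noise

/-! ### Noise along an adaptive sequence of points. -/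

section Sampling

variable {Ω Ξ Q E : Type*} [mΩ : MeasurableSpace Ω] [MeasurableSpace Ξ] [MeasurableSpace Q]
  [NormedAddCommGroup E] [InnerProductSpace ℝ E] [MeasurableSpace E] [BorelSpace E]
  [SecondCountableTopology E] [CompleteSpace E] {P : Measure Ω} [IsProbabilityMeasure P] {n T K : ℕ}
  {D : Fin n → Measure Ξ} [∀ i, IsProbabilityMeasure (D i)] {ξ : Fin n → ℕ → ℕ → Ω → Ξ}

/-- Centred noise with variance at most `σ ^ 2`, at a point of `Q` and a sample of `Ξ`. -/
structure CentredNoise (D : Fin n → Measure Ξ) (g : Fin n → Q → Ξ → E) (σ : ℝ) : Prop where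
  meas : ∀ i, Measurable (Function.uncurry (g i))
  integrable : ∀ i q, Integrable (g i q) (D i)
  mean_zero : ∀ i q, ∫ z, g i q z ∂(D i) = 0
  sq_integrable : ∀ i q, Integrable (fun z => ‖g i q z‖ ^ 2) (D i)
  variance_le : ∀ i q, ∫ z, ‖g i q z‖ ^ 2 ∂(D i) ≤ σ ^ 2

/-- The σ-algebra generated by all samples but the one with index `p`. -/
@[reducible] def othersAlgebra (T K : ℕ) (ξ : Fin n → ℕ → ℕ → Ω → Ξ) (p : Fin n × Fin T × Fin K) :
    MeasurableSpace Ω :=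
  ⨆ r ∈ {r | r ≠ p}, MeasurableSpace.comap (ξ r.1 r.2.1 r.2.2) inferInstance

/-- The point `q i t k` is determined by the samples of the rounds before `t` and by those of
client `i` at the local steps before `k` of round `t`. -/
def Nonanticipating (T K : ℕ) (ξ : Fin n → ℕ → ℕ → Ω → Ξ) (q : Fin n → ℕ → ℕ → Ω → Q) : Prop :=
  ∀ i t k, t < T → k ≤ K → ∀ m : MeasurableSpace Ω,
    (∀ j s l, s < T → l < K → (s < t ∨ s = t ∧ j = i ∧ l < k) → Measurable[m] (ξ j s l)) →
      Measurable[m] (q i t k)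

lemma measurable_othersAlgebra {p : Fin n × Fin T × Fin K} {j : Fin n} {s l : ℕ} (hs : s < T)
    (hl : l < K) (h : j ≠ p.1 ∨ s ≠ p.2.1 ∨ l ≠ p.2.2) :
    Measurable[othersAlgebra T K ξ p] (ξ j s l) := by
  have hne : ((j, ⟨s, hs⟩, ⟨l, hl⟩) : Fin n × Fin T × Fin K) ≠ p := by
    rintro rfl
    simp at h
  refine Measurable.mono (comap_measurable (ξ j s l)) ?_ le_rfl
  exact le_iSup₂_of_le (f := fun (r : Fin n × Fin T × Fin K) (_ : r ∈ {r | r ≠ p}) =>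
    MeasurableSpace.comap (ξ r.1 r.2.1 r.2.2) inferInstance) (j, ⟨s, hs⟩, ⟨l, hl⟩) hne le_rfl

lemma othersAlgebra_le (hξ : Samples P D T K ξ) (p : Fin n × Fin T × Fin K) :
    othersAlgebra T K ξ p ≤ mΩ :=
  iSup₂_le fun r _ => (hξ.meas r.1 _ r.2.1.2 _ r.2.2.2).comap_le

/-- Taking the identity of `Ω`, with the σ-algebra of the other samples on the target, as the
variable `Y` makes everything determined by those samples a function of `Y`. Conditional
expectations are thereby avoided. -/
lemma indepFun_id_othersAlgebra (hξ : Samples P D T K ξ) (p : Fin n × Fin T × Fin K) :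
    @IndepFun Ω Ω Ξ mΩ (othersAlgebra T K ξ p) _ id (ξ p.1 p.2.1 p.2.2) P := by
  have h := indep_iSup_of_disjoint
    (m := fun r : Fin n × Fin T × Fin K => MeasurableSpace.comap (ξ r.1 r.2.1 r.2.2) inferInstance)
    (fun r => (hξ.meas r.1 _ r.2.1.2 _ r.2.2.2).comap_le) hξ.indep.iIndep
    (S := {r | r ≠ p}) (T := {p}) (by simp)
  rw [iSup_singleton] at h
  refine (@IndepFun_iff_Indep Ω Ω Ξ mΩ (othersAlgebra T K ξ p) _ id _ P).2 ?_
  rw [MeasurableSpace.comap_id]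
  exact h

variable {g : Fin n → Q → Ξ → E} {σ : ℝ} {q : Fin n → ℕ → ℕ → Ω → Q}

/-- The client `j` is arbitrary: apart from earlier rounds, the point at step `l` uses only samples
at steps before `l`, hence never the sample `p`. -/
lemma Nonanticipating.measurable_others (hq : Nonanticipating T K ξ q)
    {p : Fin n × Fin T × Fin K} {j : Fin n} {l : ℕ} (hl : l ≤ p.2.2) :
    Measurable[othersAlgebra T K ξ p] (q j p.2.1 l) := by
  refine hq j _ l p.2.1.2 (hl.trans p.2.2.2.le) _ fun i s k hs hk h => ?_
  refine measurable_othersAlgebra hs hk ?_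
  rcases h with h | ⟨-, -, h⟩
  · exact .inr (.inl h.ne)
  · exact .inr (.inr (h.trans_le hl).ne)

lemma Nonanticipating.measurable_noise_others (hq : Nonanticipating T K ξ q)
    (hg : CentredNoise D g σ) {p : Fin n × Fin T × Fin K} {j : Fin n} {l : ℕ} (hl : l ≤ p.2.2)
    (hjl : j ≠ p.1 ∨ l ≠ p.2.2) :
    Measurable[othersAlgebra T K ξ p] fun ω => g j (q j p.2.1 l ω) (ξ j p.2.1 l ω) := by
  have h1 := hq.measurable_others (j := j) hl
  have h2 : Measurable[othersAlgebra T K ξ p] (ξ j p.2.1 l) :=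
    measurable_othersAlgebra p.2.1.2 (hl.trans_lt p.2.2.2) (by tauto)
  exact (hg.meas j).comp (h1.prodMk h2)

lemma CentredNoise.measurable_comp_id (hg : CentredNoise D g σ) {m : MeasurableSpace Ω} {i : Fin n}
    {f : Ω → Q} (hf : Measurable[m] f) :
    @Measurable (Ω × Ξ) E (m.prod inferInstance) _ (Function.uncurry fun ω z => g i (f ω) z) :=
  (hg.meas i).comp ((hf.comp measurable_fst).prodMk measurable_snd)

lemma memLp_noise_and_le (hξ : Samples P D T K ξ) (hq : Nonanticipating T K ξ q)
    (hg : CentredNoise D g σ) (i : Fin n) {t k : ℕ} (ht : t < T) (hk : k < K) :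
    MemLp (fun ω => g i (q i t k ω) (ξ i t k ω)) 2 P ∧
      ∫ ω, ‖g i (q i t k ω) (ξ i t k ω)‖ ^ 2 ∂P ≤ σ ^ 2 := by
  let p : Fin n × Fin T × Fin K := (i, ⟨t, ht⟩, ⟨k, hk⟩)
  have hid : @Measurable Ω Ω mΩ (othersAlgebra T K ξ p) id :=
    measurable_id'' (othersAlgebra_le hξ p)
  exact memLp_and_integral_norm_sq_le (g := fun ω z => g i (q i t k ω) z) hid
    (hξ.meas i t ht k hk) (hξ.law i t ht k hk) (indepFun_id_othersAlgebra hξ p)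
    (hg.measurable_comp_id (hq.measurable_others (p := p) le_rfl)) (fun _ => hg.sq_integrable i _)
    (fun _ => hg.variance_le i _)

lemma integral_inner_noise_eq_zero (hξ : Samples P D T K ξ) (hq : Nonanticipating T K ξ q)
    (hg : CentredNoise D g σ) (i : Fin n) {t k : ℕ} (ht : t < T) (hk : k < K) {H : Ω → E}
    (hH : Measurable[othersAlgebra T K ξ (i, ⟨t, ht⟩, ⟨k, hk⟩)] H) (hHL : MemLp H 2 P) :
    ∫ ω, inner ℝ (H ω) (g i (q i t k ω) (ξ i t k ω)) ∂P = 0 := by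
  let p : Fin n × Fin T × Fin K := (i, ⟨t, ht⟩, ⟨k, hk⟩)
  have hid : @Measurable Ω Ω mΩ (othersAlgebra T K ξ p) id :=
    measurable_id'' (othersAlgebra_le hξ p)
  exact integral_inner_eq_zero_of_indepFun (g := fun ω z => g i (q i t k ω) z) hid
    (hξ.meas i t ht k hk) (hξ.law i t ht k hk) (indepFun_id_othersAlgebra hξ p)
    (hg.measurable_comp_id (hq.measurable_others (p := p) le_rfl)) (fun _ => hg.integrable i _)
    (fun _ => hg.mean_zero i _) hH hHL (memLp_noise_and_le hξ hq hg i ht hk).1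

/-- The noise of the later step has mean zero given all other samples, and these determine the other
noise term. The same argument covers two clients at equal steps. -/
lemma integral_inner_noise_noise_eq_zero (hξ : Samples P D T K ξ) (hq : Nonanticipating T K ξ q)
    (hg : CentredNoise D g σ) {t : ℕ} (ht : t < T) {i j : Fin n} {k l : ℕ} (hk : k < K)
    (hl : l < K) (h : (j, l) ≠ (i, k)) :
    ∫ ω, inner ℝ (g j (q j t l ω) (ξ j t l ω)) (g i (q i t k ω) (ξ i t k ω)) ∂P = 0 := by
  wlog hlk : l ≤ k generalizing i j k l
  · simp_rw [real_inner_comm]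
    exact this hl hk h.symm (le_of_not_ge hlk)
  refine integral_inner_noise_eq_zero hξ hq hg i ht hk ?_ (memLp_noise_and_le hξ hq hg j ht hl).1
  refine hq.measurable_noise_others hg (p := (i, ⟨t, ht⟩, ⟨k, hk⟩)) hlk ?_
  by_contra! hc
  exact h (Prod.ext hc.1 hc.2)

lemma integral_norm_sum_noise_sq_le (hξ : Samples P D T K ξ) (hq : Nonanticipating T K ξ q)
    (hg : CentredNoise D g σ) {t : ℕ} (ht : t < T) (s : Finset (Fin n)) {k : ℕ} (hk : k ≤ K) :
    ∫ ω, ‖∑ i ∈ s, ∑ j ∈ Finset.range k, g i (q i t j ω) (ξ i t j ω)‖ ^ 2 ∂P ≤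
      s.card * k * σ ^ 2 := by
  simp_rw [← Finset.sum_product']
  have hlt : ∀ r ∈ s ×ˢ Finset.range k, r.2 < K := fun r hr =>
    (Finset.mem_range.1 (Finset.mem_product.1 hr).2).trans_le hk
  refine (integral_norm_sum_sq_le (P := P) (c := σ ^ 2) (s ×ˢ Finset.range k)
    (e := fun r ω => g r.1 (q r.1 t r.2 ω) (ξ r.1 t r.2 ω))
    (fun r hr => (memLp_noise_and_le hξ hq hg r.1 ht (hlt r hr)).1)
    (fun r hr r' hr' h => integral_inner_noise_noise_eq_zero hξ hq hg ht (hlt r' hr') (hlt r hr) h)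
    (fun r hr => (memLp_noise_and_le hξ hq hg r.1 ht (hlt r hr)).2)).trans (le_of_eq ?_)
  rw [Finset.card_product, Finset.card_range]
  push_cast
  ring

lemma memLp_sum_noise (hξ : Samples P D T K ξ) (hq : Nonanticipating T K ξ q)
    (hg : CentredNoise D g σ) {t : ℕ} (ht : t < T) (i : Fin n) {k : ℕ} (hk : k ≤ K) :
    MemLp (fun ω => ∑ j ∈ Finset.range k, g i (q i t j ω) (ξ i t j ω)) 2 P :=
  memLp_finsetSum _ fun _ hj =>
    (memLp_noise_and_le hξ hq hg i ht ((Finset.mem_range.1 hj).trans_le hk)).1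

lemma integral_inner_sum_noise_eq_zero (hξ : Samples P D T K ξ) (hq : Nonanticipating T K ξ q)
    (hg : CentredNoise D g σ) (i : Fin n) {t : ℕ} (ht : t < T) {H : Ω → E}
    (hH : ∀ p : Fin n × Fin T × Fin K, p.2.1 = t → Measurable[othersAlgebra T K ξ p] H)
    (hHL : MemLp H 2 P) :
    ∫ ω, inner ℝ (H ω) (∑ k ∈ Finset.range K, g i (q i t k ω) (ξ i t k ω)) ∂P = 0 := by
  simp_rw [inner_sum]
  rw [integral_finsetSum _ fun k hk => integrable_inner_of_memLp hHL
    (memLp_noise_and_le hξ hq hg i ht (Finset.mem_range.1 hk)).1]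
  exact Finset.sum_eq_zero fun k hk =>
    integral_inner_noise_eq_zero hξ hq hg i ht (Finset.mem_range.1 hk) (hH _ rfl) hHL

end Sampling

lemma integrable_norm_sq_of_memLp {Ω E : Type*} [MeasurableSpace Ω] [NormedAddCommGroup E]
    {P : Measure Ω} {f : Ω → E} (hf : MemLp f 2 P) : Integrable (fun ω => ‖f ω‖ ^ 2) P :=
  (memLp_two_iff_integrable_sq_norm hf.1).1 hf

/-! ### Expected size of the noise in one round. -/

section NoiseBounds

variable {Ω Ξ Q U V : Type*} [mΩ : MeasurableSpace Ω] [MeasurableSpace Ξ] [MeasurableSpace Q]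
  [NormedAddCommGroup U] [InnerProductSpace ℝ U] [MeasurableSpace U] [BorelSpace U]
  [SecondCountableTopology U] [CompleteSpace U]
  [NormedAddCommGroup V] [InnerProductSpace ℝ V] [MeasurableSpace V] [BorelSpace V]
  [SecondCountableTopology V] [CompleteSpace V]
  {P : Measure Ω} [IsProbabilityMeasure P] {n T K : ℕ}
  {D : Fin n → Measure Ξ} [∀ i, IsProbabilityMeasure (D i)] {ξ : Fin n → ℕ → ℕ → Ω → Ξ}
  {gu : Fin n → Q → Ξ → U} {gv : Fin n → Q → Ξ → V} {σu σv : ℝ} {q : Fin n → ℕ → ℕ → Ω → Q}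

/-- The `u`-noise is averaged before squaring and gains `1 / n` from independence of the clients;
the `v`-noise is averaged only after squaring and gains nothing. -/
lemma integrable_noiseSq_and_le (hn : 1 ≤ n) (hξ : Samples P D T K ξ)
    (hq : Nonanticipating T K ξ q)
    (hgu : CentredNoise D gu σu) (hgv : CentredNoise D gv σv) {t : ℕ} (ht : t < T) :
    Integrable (fun ω => noiseSq K (fun i k => gu i (q i t k ω) (ξ i t k ω))
        (fun i k => gv i (q i t k ω) (ξ i t k ω))) P ∧
      ∫ ω, noiseSq K (fun i k => gu i (q i t k ω) (ξ i t k ω))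
        (fun i k => gv i (q i t k ω) (ξ i t k ω)) ∂P ≤ K * (σu ^ 2 / n + σv ^ 2) := by
  have hn' : (0 : ℝ) < n := by exact_mod_cast hn
  have hu : MemLp (fun ω => (1 / (n : ℝ)) • ∑ i, ∑ k ∈ Finset.range K,
      gu i (q i t k ω) (ξ i t k ω)) 2 P :=
    (memLp_finsetSum Finset.univ fun i _ => memLp_sum_noise hξ hq hgu ht i le_rfl).const_smul _
  have hIu := integrable_norm_sq_of_memLp hu
  have hIv := fun i => integrable_norm_sq_of_memLp (memLp_sum_noise hξ hq hgv ht i le_rfl)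
  have hIv' : Integrable (fun ω => (1 / (n : ℝ)) * ∑ i, ‖∑ k ∈ Finset.range K,
      gv i (q i t k ω) (ξ i t k ω)‖ ^ 2) P :=
    (integrable_finsetSum Finset.univ fun i _ => hIv i).const_mul _
  refine ⟨hIu.add hIv', ?_⟩
  simp only [noiseSq]
  rw [integral_add hIu hIv', integral_const_mul, integral_finsetSum _ fun i _ => hIv i]
  simp_rw [norm_smul, mul_pow]
  rw [integral_const_mul]
  have h1 := integral_norm_sum_noise_sq_le hξ hq hgu ht Finset.univ (le_refl K)
  have h2 : ∀ i ∈ Finset.univ, ∫ ω, ‖∑ k ∈ Finset.range K, gv i (q i t k ω) (ξ i t k ω)‖ ^ 2 ∂P ≤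
      K * σv ^ 2 := fun i _ => by
    simpa using integral_norm_sum_noise_sq_le hξ hq hgv ht {i} (le_refl K)
  have h3 := mul_le_mul_of_nonneg_left (Finset.sum_le_sum h2) (by positivity : 0 ≤ 1 / (n : ℝ))
  have h4 := mul_le_mul_of_nonneg_left h1 (by positivity : 0 ≤ ‖1 / (n : ℝ)‖ ^ 2)
  refine (add_le_add h4 h3).trans (le_of_eq ?_)
  rw [Real.norm_of_nonneg (by positivity)]
  simp only [Finset.sum_const, Finset.card_univ, Fintype.card_fin, nsmul_eq_mul]
  field_simp

/-- Inside a client nothing is averaged, so no `1 / n` appears here. One factor `K` counts the local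
steps, the other bounds the number of noise terms accumulated before each. -/
lemma integrable_localNoiseSq_and_le (hn : 1 ≤ n) (hξ : Samples P D T K ξ)
    (hq : Nonanticipating T K ξ q) (hgu : CentredNoise D gu σu) (hgv : CentredNoise D gv σv)
    (γu γv : ℝ) {t : ℕ} (ht : t < T) :
    Integrable (fun ω => localNoiseSq K γu γv (fun i k => gu i (q i t k ω) (ξ i t k ω))
        (fun i k => gv i (q i t k ω) (ξ i t k ω))) P ∧
      ∫ ω, localNoiseSq K γu γv (fun i k => gu i (q i t k ω) (ξ i t k ω))
        (fun i k => gv i (q i t k ω) (ξ i t k ω)) ∂P ≤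
        (K : ℝ) ^ 2 * (γu ^ 2 * σu ^ 2 + γv ^ 2 * σv ^ 2) := by
  have hn' : (0 : ℝ) < n := by exact_mod_cast hn
  have hIu := fun i k (hk : k ∈ Finset.range K) => (integrable_norm_sq_of_memLp
    (memLp_sum_noise hξ hq hgu ht i (Finset.mem_range.1 hk).le)).const_mul (γu ^ 2)
  have hIv := fun i k (hk : k ∈ Finset.range K) => (integrable_norm_sq_of_memLp
    (memLp_sum_noise hξ hq hgv ht i (Finset.mem_range.1 hk).le)).const_mul (γv ^ 2)
  have hIs : ∀ i, ∀ k ∈ Finset.range K, Integrable (fun ω =>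
      γu ^ 2 * ‖∑ j ∈ Finset.range k, gu i (q i t j ω) (ξ i t j ω)‖ ^ 2 +
        γv ^ 2 * ‖∑ j ∈ Finset.range k, gv i (q i t j ω) (ξ i t j ω)‖ ^ 2) P :=
    fun i k hk => (hIu i k hk).add (hIv i k hk)
  have hI := fun i => integrable_finsetSum (Finset.range K) (hIs i)
  refine ⟨(integrable_finsetSum Finset.univ fun i _ => hI i).const_mul _, ?_⟩
  simp only [localNoiseSq]
  rw [integral_const_mul, integral_finsetSum _ fun i _ => hI i]
  have h1 : ∀ i ∈ Finset.univ, ∫ ω, ∑ k ∈ Finset.range K,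
      (γu ^ 2 * ‖∑ j ∈ Finset.range k, gu i (q i t j ω) (ξ i t j ω)‖ ^ 2 +
        γv ^ 2 * ‖∑ j ∈ Finset.range k, gv i (q i t j ω) (ξ i t j ω)‖ ^ 2) ∂P ≤
      (K : ℝ) ^ 2 * (γu ^ 2 * σu ^ 2 + γv ^ 2 * σv ^ 2) := fun i _ => by
    rw [integral_finsetSum _ (hIs i)]
    have h2 : ∀ k ∈ Finset.range K, ∫ ω,
        (γu ^ 2 * ‖∑ j ∈ Finset.range k, gu i (q i t j ω) (ξ i t j ω)‖ ^ 2 +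
          γv ^ 2 * ‖∑ j ∈ Finset.range k, gv i (q i t j ω) (ξ i t j ω)‖ ^ 2) ∂P ≤
        K * (γu ^ 2 * σu ^ 2 + γv ^ 2 * σv ^ 2) := fun k hk => by
      have hk' := (Finset.mem_range.1 hk).le
      rw [integral_add (hIu i k hk) (hIv i k hk), integral_const_mul, integral_const_mul]
      have h3 := integral_norm_sum_noise_sq_le hξ hq hgu ht {i} hk'
      have h4 := integral_norm_sum_noise_sq_le hξ hq hgv ht {i} hk'
      simp only [Finset.sum_singleton, Finset.card_singleton, Nat.cast_one, one_mul] at h3 h4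
      calc _ ≤ γu ^ 2 * (k * σu ^ 2) + γv ^ 2 * (k * σv ^ 2) := by gcongr
        _ ≤ γu ^ 2 * (K * σu ^ 2) + γv ^ 2 * (K * σv ^ 2) := by gcongr
        _ = _ := by ring
    refine (Finset.sum_le_sum h2).trans (le_of_eq ?_)
    rw [Finset.sum_const, Finset.card_range, nsmul_eq_mul]
    ring
  refine (mul_le_mul_of_nonneg_left (Finset.sum_le_sum h1) (by positivity)).trans (le_of_eq ?_)
  simp only [Finset.sum_const, Finset.card_univ, Fintype.card_fin, nsmul_eq_mul]
  field_simp

/-- The gradients at the start of a round do not depend on the samples of that round, so they are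
orthogonal to each noise term. -/
lemma integrable_noiseInner_and_eq_zero (hξ : Samples P D T K ξ) (hq : Nonanticipating T K ξ q)
    (hgu : CentredNoise D gu σu) (hgv : CentredNoise D gv σv) {t : ℕ} (ht : t < T)
    {Gu : Fin n → U → V → U} {Gv : Fin n → U → V → V} {x : Ω → U} {y : Ω → Fin n → V}
    (hGu : ∀ i, MemLp (fun ω => Gu i (x ω) (y ω i)) 2 P)
    (hGv : ∀ i, MemLp (fun ω => Gv i (x ω) (y ω i)) 2 P)
    (hGum : ∀ i, ∀ p : Fin n × Fin T × Fin K, p.2.1 = t →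
      Measurable[othersAlgebra T K ξ p] fun ω => Gu i (x ω) (y ω i))
    (hGvm : ∀ i, ∀ p : Fin n × Fin T × Fin K, p.2.1 = t →
      Measurable[othersAlgebra T K ξ p] fun ω => Gv i (x ω) (y ω i)) :
    Integrable (fun ω => noiseInner Gu Gv K (x ω) (y ω) (fun i k => gu i (q i t k ω) (ξ i t k ω))
        (fun i k => gv i (q i t k ω) (ξ i t k ω))) P ∧
      ∫ ω, noiseInner Gu Gv K (x ω) (y ω) (fun i k => gu i (q i t k ω) (ξ i t k ω))
        (fun i k => gv i (q i t k ω) (ξ i t k ω)) ∂P = 0 := by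
  have ha : MemLp (fun ω => (1 / (n : ℝ)) • ∑ i, Gu i (x ω) (y ω i)) 2 P :=
    (memLp_finsetSum Finset.univ fun i _ => hGu i).const_smul _
  have ham : ∀ p : Fin n × Fin T × Fin K, p.2.1 = t → Measurable[othersAlgebra T K ξ p]
      fun ω => (1 / (n : ℝ)) • ∑ i, Gu i (x ω) (y ω i) := fun p hp =>
    (Finset.measurable_sum Finset.univ fun i _ => hGum i p hp).const_smul _
  have hIu := fun i => integrable_inner_of_memLp ha (memLp_sum_noise hξ hq hgu ht i le_rfl)
  have hIv := fun i => integrable_inner_of_memLp (hGv i) (memLp_sum_noise hξ hq hgv ht i le_rfl)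
  have hIu' : Integrable (fun ω => (1 / (n : ℝ)) * ∑ i, (inner ℝ
      ((1 / (n : ℝ)) • ∑ i, Gu i (x ω) (y ω i))
      (∑ k ∈ Finset.range K, gu i (q i t k ω) (ξ i t k ω)) : ℝ)) P :=
    (integrable_finsetSum Finset.univ fun i _ => hIu i).const_mul _
  have hIv' : Integrable (fun ω => (1 / (n : ℝ)) * ∑ i, (inner ℝ (Gv i (x ω) (y ω i))
      (∑ k ∈ Finset.range K, gv i (q i t k ω) (ξ i t k ω)) : ℝ)) P :=
    (integrable_finsetSum Finset.univ fun i _ => hIv i).const_mul _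
  unfold noiseInner
  simp only [real_inner_smul_right, inner_sum Finset.univ]
  refine ⟨hIu'.add hIv', ?_⟩
  rw [integral_add hIu' hIv', integral_const_mul, integral_const_mul,
    integral_finsetSum _ fun i _ => hIu i, integral_finsetSum _ fun i _ => hIv i,
    Finset.sum_eq_zero fun i _ => integral_inner_sum_noise_eq_zero hξ hq hgu i ht ham ha,
    Finset.sum_eq_zero fun i _ => integral_inner_sum_noise_eq_zero hξ hq hgv i ht (hGvm i) (hGv i)]
  simp

end NoiseBounds

/-! ### FedAvg-P as a sequence of noisy rounds. -/

section Algorithm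

variable {du dv n : ℕ} {Ω Ξ : Type*} [mΩ : MeasurableSpace Ω] [MeasurableSpace Ξ]
  {F : Vec du → Vec dv → Ξ → ℝ} {D : Fin n → Measure Ξ} [∀ i, IsProbabilityMeasure (D i)]

lemma Smooth.lipschitzGrads {f : Fin n → Vec du → Vec dv → ℝ} {Lu Luv Lv Lvu : NNReal}
    (h : Smooth f Lu Luv Lv Lvu) {L : ℝ}
    (hL : L = max (max (Lu : ℝ) (Lv : ℝ)) (max (Luv : ℝ) (Lvu : ℝ))) :
    LipschitzGrads f (fun i => gradU (f i)) (fun i => gradV (f i)) L := by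
  have hu : (Lu : ℝ) ≤ L := by simp [hL]
  have hv : (Lv : ℝ) ≤ L := by simp [hL]
  have huv : (Luv : ℝ) ≤ L := by simp [hL]
  have hvu : (Lvu : ℝ) ≤ L := by simp [hL]
  refine ⟨Lu.2.trans hu, fun i u v => (h.diff_u i v u).hasGradientAt,
    fun i u v => (h.diff_v i u v).hasGradientAt, fun i u u' v => ?_, fun i u v v' => ?_,
    fun i u v v' => ?_, fun i u u' v => ?_⟩
  · have := (h.lip_uu i v).dist_le_mul u u'
    rw [dist_eq_norm, dist_eq_norm] at this
    exact this.trans (by gcongr)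
  · have := (h.lip_uv i u).dist_le_mul v v'
    rw [dist_eq_norm, dist_eq_norm] at this
    exact this.trans (by gcongr)
  · have := (h.lip_vv i u).dist_le_mul v v'
    rw [dist_eq_norm, dist_eq_norm] at this
    exact this.trans (by gcongr)
  · have := (h.lip_vu i v).dist_le_mul u u'
    rw [dist_eq_norm, dist_eq_norm] at this
    exact this.trans (by gcongr)

lemma globalGradU_eq (h : ∀ i v, Differentiable ℝ fun u => clientObj F D i u v) (u : Vec du)
    (v : Fin n → Vec dv) :
    globalGradU F D u v = (1 / (n : ℝ)) • ∑ i, gradU (clientObj F D i) u (v i) := by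
  refine HasGradientAt.gradient ?_
  rw [hasGradientAt_iff_hasFDerivAt, map_smul, map_sum]
  unfold globalObj
  have h1 := HasFDerivAt.fun_sum (u := Finset.univ)
    fun i (_ : i ∈ Finset.univ) => ((h i (v i) u).hasGradientAt).hasFDerivAt
  exact h1.const_mul (1 / (n : ℝ))

/-- Here `n` is merely the dimension of the target, so the statement serves both partial gradients.
-/
lemma measurable_of_norm_sub_le {G : Vec du → Vec dv → Vec n} {L : ℝ} (hL : 0 ≤ L)
    (h : ∀ u v u' v', ‖G u v - G u' v'‖ ≤ L * ‖u - u'‖ + L * ‖v - v'‖) :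
    Measurable fun p : Vec du × Vec dv => G p.1 p.2 := by
  refine LipschitzWith.continuous (K := ⟨2 * L, by positivity⟩)
    (LipschitzWith.of_dist_le_mul fun p p' => ?_) |>.measurable
  rw [dist_eq_norm]
  have h1 : ‖p.1 - p'.1‖ ≤ dist p p' := by rw [← dist_eq_norm]; exact le_max_left _ _
  have h2 : ‖p.2 - p'.2‖ ≤ dist p p' := by rw [← dist_eq_norm]; exact le_max_right _ _
  refine (h p.1 p.2 p'.1 p'.2).trans ?_
  change _ ≤ 2 * L * dist p p'
  nlinarith

lemma memLp_of_norm_sub_le {P : Measure Ω} [IsProbabilityMeasure P]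
    {G : Vec du → Vec dv → Vec n} {L : ℝ} (hL : 0 ≤ L)
    (h : ∀ u v u' v', ‖G u v - G u' v'‖ ≤ L * ‖u - u'‖ + L * ‖v - v'‖) {x : Ω → Vec du}
    {y : Ω → Vec dv} (hx : MemLp x 2 P) (hy : MemLp y 2 P) :
    MemLp (fun ω => G (x ω) (y ω)) 2 P := by
  have hc := measurable_of_norm_sub_le hL h
  have hm : AEStronglyMeasurable (fun ω => G (x ω) (y ω)) P :=
    (hc.comp_aemeasurable (hx.1.aemeasurable.prodMk hy.1.aemeasurable)).aestronglyMeasurable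
  refine MemLp.of_le (((memLp_const ‖G 0 0‖).add (hx.norm.const_mul L)).add
    (hy.norm.const_mul L)) hm (.of_forall fun ω => ?_)
  refine le_trans ?_ (le_abs_self _)
  have h1 := norm_le_norm_add_norm_sub' (G (x ω) (y ω)) (G 0 0)
  have h2 := h (x ω) (y ω) 0 0
  simp only [sub_zero] at h2
  simp only [Pi.add_apply]
  linarith

/-- The σ-algebra on `α` is left free: taking one generated by some of the samples turns
measurability into the statement that the iterate depends on these samples only. -/
lemma measurable_localIter {α : Type*} {m : MeasurableSpace α} {σu σv : ℝ}
    (hg : StochGrad F D σu σv) (γu γv : ℝ) {z : ℕ → α → Ξ} {p : α → Vec du × Vec dv}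
    (hp : Measurable p) {k : ℕ} (hz : ∀ j < k, Measurable (z j)) :
    Measurable fun a => localIter F γu γv (fun j => z j a) (p a) k := by
  induction k with
  | zero => exact hp
  | succ k ih =>
    have h1 := ih fun j hj => hz j (hj.trans k.lt_succ_self)
    have h2 := h1.fst.prodMk (h1.snd.prodMk (hz k k.lt_succ_self))
    exact (h1.fst.sub ((hg.meas_u.comp h2).const_smul γu)).prodMk
      (h1.snd.sub ((hg.meas_v.comp h2).const_smul γv))

lemma measurable_fedAvgP {α : Type*} {m : MeasurableSpace α} {σu σv : ℝ}
    (hg : StochGrad F D σu σv) (γu γv ηu ηv : ℝ) {K : ℕ} (u0 : Vec du) (v0 : Fin n → Vec dv)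
    {z : Fin n → ℕ → ℕ → α → Ξ} {t : ℕ} (hz : ∀ i, ∀ s < t, ∀ k < K, Measurable (z i s k)) :
    Measurable fun a => fedAvgP F γu γv ηu ηv K (fun _ => Finset.univ) u0 v0
      (fun i s k => z i s k a) t := by
  induction t with
  | zero => exact measurable_const
  | succ t ih =>
    have h1 := ih fun i s hs => hz i s (hs.trans t.lt_succ_self)
    have h2 := fun i => measurable_localIter hg γu γv
      (h1.fst.prodMk ((measurable_pi_apply i).comp h1.snd)) (hz i t t.lt_succ_self)
    simp only [fedAvgP, Finset.mem_univ, if_true]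
    refine ((h1.fst.const_smul (1 - ηu)).add ((Finset.measurable_sum _ fun i _ =>
      (h2 i).fst).const_smul (ηu / _))).prodMk (measurable_pi_lambda _ fun i => ?_)
    exact (((measurable_pi_apply i).comp h1.snd).const_smul (1 - ηv)).add
      ((h2 i).snd.const_smul ηv)

/-- The iterate of FedAvg-P with full participation at the beginning of round `t`. -/
def iterate (F : Vec du → Vec dv → Ξ → ℝ) (γu γv ηu ηv : ℝ) (K : ℕ) (u0 : Vec du)
    (v0 : Fin n → Vec dv) (ξ : Fin n → ℕ → ℕ → Ω → Ξ) (t : ℕ) (ω : Ω) :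
    Vec du × (Fin n → Vec dv) :=
  fedAvgP F γu γv ηu ηv K (fun _ => Finset.univ) u0 v0 (fun i s k => ξ i s k ω) t

/-- The local iterate of client `i` at local step `k` of round `t`, when the iterates at the
beginning of the rounds are `X`. -/
def localPoint (F : Vec du → Vec dv → Ξ → ℝ) (γu γv : ℝ) (ξ : Fin n → ℕ → ℕ → Ω → Ξ)
    (X : ℕ → Ω → Vec du × (Fin n → Vec dv)) (i : Fin n) (t k : ℕ) (ω : Ω) : Vec du × Vec dv :=
  localIter F γu γv (fun j => ξ i t j ω) ((X t ω).1, (X t ω).2 i) k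

/-- The error of the sample gradient in the shared variable. -/
def noiseU (F : Vec du → Vec dv → Ξ → ℝ) (D : Fin n → Measure Ξ) (i : Fin n)
    (q : Vec du × Vec dv) (z : Ξ) : Vec du :=
  gradU (fun u v => F u v z) q.1 q.2 - gradU (clientObj F D i) q.1 q.2

/-- The error of the sample gradient in the personal variable. -/
def noiseV (F : Vec du → Vec dv → Ξ → ℝ) (D : Fin n → Measure Ξ) (i : Fin n)
    (q : Vec du × Vec dv) (z : Ξ) : Vec dv :=
  gradV (fun u v => F u v z) q.1 q.2 - gradV (clientObj F D i) q.1 q.2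

variable {σu σv L : ℝ}

lemma centredNoise_noiseU (hg : StochGrad F D σu σv)
    (hf : LipschitzGrads (clientObj F D) (fun i => gradU (clientObj F D i))
      (fun i => gradV (clientObj F D i)) L) : CentredNoise D (noiseU F D) σu where
  meas i := (hg.meas_u.comp (measurable_fst.fst.prodMk (measurable_fst.snd.prodMk
    measurable_snd))).sub ((measurable_of_norm_sub_le hf.nonneg (hf.norm_sub_u_le i)).comp
      measurable_fst)
  integrable i q := (hg.integrable_u i q.1 q.2).sub (integrable_const _)
  mean_zero i q := by
    simp only [noiseU]
    rw [integral_sub (hg.integrable_u i q.1 q.2) (integrable_const _), hg.unbiased_u]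
    simp
  sq_integrable i q := hg.sq_integrable_u i q.1 q.2
  variance_le i q := hg.variance_u i q.1 q.2

lemma centredNoise_noiseV (hg : StochGrad F D σu σv)
    (hf : LipschitzGrads (clientObj F D) (fun i => gradU (clientObj F D i))
      (fun i => gradV (clientObj F D i)) L) : CentredNoise D (noiseV F D) σv where
  meas i := (hg.meas_v.comp (measurable_fst.fst.prodMk (measurable_fst.snd.prodMk
    measurable_snd))).sub ((measurable_of_norm_sub_le hf.nonneg (hf.norm_sub_v_le i)).comp
      measurable_fst)
  integrable i q := (hg.integrable_v i q.1 q.2).sub (integrable_const _)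
  mean_zero i q := by
    simp only [noiseV]
    rw [integral_sub (hg.integrable_v i q.1 q.2) (integrable_const _), hg.unbiased_v]
    simp
  sq_integrable i q := hg.sq_integrable_v i q.1 q.2
  variance_le i q := hg.variance_v i q.1 q.2

variable {γ γu γv ηu ηv : ℝ} {T K : ℕ} {u0 : Vec du} {v0 : Fin n → Vec dv}
  {ξ : Fin n → ℕ → ℕ → Ω → Ξ}

lemma nonanticipating_localPoint (hg : StochGrad F D σu σv) :
    Nonanticipating T K ξ (localPoint F γu γv ξ (iterate F γu γv ηu ηv K u0 v0 ξ)) := by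
  intro i t k ht hk m hm
  have h1 : Measurable[m] (iterate F γu γv ηu ηv K u0 v0 ξ t) :=
    measurable_fedAvgP hg γu γv ηu ηv u0 v0 fun j s hs l hl =>
      hm j s l (hs.trans ht) hl (.inl hs)
  exact measurable_localIter hg γu γv
    (h1.fst.prodMk ((measurable_pi_apply i).comp h1.snd)) fun j hj =>
      hm i t j ht (hj.trans_le hk) (.inr ⟨rfl, rfl, hj⟩)

lemma localIter_sub_eq (z : ℕ → Ξ) (p : Vec du × Vec dv) (k : ℕ) :
    (localIter F γu γv z p k).1 = p.1 - γu • ∑ j ∈ Finset.range k, gradU (fun u v => F u v (z j))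
        (localIter F γu γv z p j).1 (localIter F γu γv z p j).2 ∧
      (localIter F γu γv z p k).2 = p.2 - γv • ∑ j ∈ Finset.range k,
        gradV (fun u v => F u v (z j)) (localIter F γu γv z p j).1
          (localIter F γu γv z p j).2 := by
  induction k with
  | zero => simp [localIter]
  | succ k ih =>
    rw [Finset.sum_range_succ, Finset.sum_range_succ, smul_add, smul_add, ← sub_sub, ← sub_sub,
      ← ih.1, ← ih.2]
    exact ⟨rfl, rfl⟩

/-- The local steps telescope, and relaxing by `ηu` multiplies their sum by `γu * ηu = γ`; the part
of weight `1 - ηu` recombines with the starting point. The same holds for `v`. -/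
lemma noisyRound_iterate (hn : 1 ≤ n) (hγu : γu * ηu = γ) (hγv : γv * ηv = γ) (t : ℕ) (ω : Ω) :
    let X := iterate F γu γv ηu ηv K u0 v0 ξ
    let q := localPoint F γu γv ξ X
    NoisyRound (fun i => gradU (clientObj F D i)) (fun i => gradV (clientObj F D i)) K γ γu γv
      (X t ω).1 (X t ω).2 (fun i k => (q i t k ω).1)
      (fun i k => noiseU F D i (q i t k ω) (ξ i t k ω)) (fun i k => (q i t k ω).2)
      (fun i k => noiseV F D i (q i t k ω) (ξ i t k ω)) (X (t + 1) ω).1 (X (t + 1) ω).2 := by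
  intro X q
  have hn' : (n : ℝ) ≠ 0 := by positivity
  have hq := fun i => localIter_sub_eq (F := F) (γu := γu) (γv := γv) (fun j => ξ i t j ω)
    ((X t ω).1, (X t ω).2 i) K
  have hX : X (t + 1) ω = ((1 - ηu) • (X t ω).1 + (ηu / (n : ℝ)) • ∑ i, (q i t K ω).1,
      fun i => (1 - ηv) • (X t ω).2 i + ηv • (q i t K ω).2) := by
    simp [X, q, iterate, fedAvgP, localPoint]
  refine ⟨fun i => rfl, fun i => rfl, fun i k => ?_, fun i k => ?_, ?_, fun i => ?_⟩
  · simp only [noiseU, add_sub_cancel]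
    rfl
  · simp only [noiseV, add_sub_cancel]
    rfl
  · simp only [noiseU, add_sub_cancel]
    rw [hX]
    have : ∀ i, (q i t K ω).1 = _ := fun i => (hq i).1
    simp only [this, Finset.sum_sub_distrib, ← Finset.smul_sum, Finset.sum_const, Finset.card_univ,
      Fintype.card_fin, ← Nat.cast_smul_eq_nsmul ℝ, smul_sub, smul_smul, ← hγu]
    rw [div_mul_cancel₀ _ hn', show γu * ηu * (1 / (n : ℝ)) = ηu / n * γu by ring]
    simp only [q, localPoint]
    module
  · simp only [noiseV, add_sub_cancel]
    rw [hX]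
    have : (q i t K ω).2 = _ := (hq i).2
    simp only [this, ← hγv]
    simp only [q, localPoint]
    module

end Algorithm

/-! ### Square integrability of the iterates and passage to expectations. -/

section Algorithm

variable {du dv n : ℕ} {Ω Ξ : Type*} [mΩ : MeasurableSpace Ω] [MeasurableSpace Ξ]
  {F : Vec du → Vec dv → Ξ → ℝ} {D : Fin n → Measure Ξ} [∀ i, IsProbabilityMeasure (D i)]
  {P : Measure Ω} [IsProbabilityMeasure P] {σu σv L γ γu γv ηu ηv : ℝ} {T K : ℕ}
  {u0 : Vec du} {v0 : Fin n → Vec dv} {ξ : Fin n → ℕ → ℕ → Ω → Ξ}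

/-- Each local step preserves square integrability, since Lipschitz gradients grow at most linearly
and the noise has bounded variance. -/
lemma memLp_localPoint (hn : 1 ≤ n) (hξ : Samples P D T K ξ) (hg : StochGrad F D σu σv)
    (hf : LipschitzGrads (clientObj F D) (fun i => gradU (clientObj F D i))
      (fun i => gradV (clientObj F D i)) L)
    (hγu : γu * ηu = γ) (hγv : γv * ηv = γ) {t : ℕ} (ht : t < T)
    (hx : MemLp (fun ω => (iterate F γu γv ηu ηv K u0 v0 ξ t ω).1) 2 P)
    (hy : ∀ i, MemLp (fun ω => (iterate F γu γv ηu ηv K u0 v0 ξ t ω).2 i) 2 P) (i : Fin n)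
    {k : ℕ} (hk : k ≤ K) :
    let q := localPoint F γu γv ξ (iterate F γu γv ηu ηv K u0 v0 ξ)
    MemLp (fun ω => (q i t k ω).1) 2 P ∧ MemLp (fun ω => (q i t k ω).2) 2 P := by
  intro q
  have hround := fun ω => noisyRound_iterate (F := F) (D := D) (K := K) (u0 := u0) (v0 := v0)
    (ξ := ξ) hn hγu hγv t ω
  have hq : Nonanticipating T K ξ q := nonanticipating_localPoint hg
  induction k with
  | zero => exact ⟨hx, hy i⟩
  | succ k ih =>
    obtain ⟨h1, h2⟩ := ih (k.le_succ.trans hk)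
    have hu := h1.sub (((memLp_of_norm_sub_le hf.nonneg (hf.norm_sub_u_le i) h1 h2).add
      (memLp_noise_and_le hξ hq (centredNoise_noiseU hg hf) i ht hk).1).const_smul γu)
    have hv := h2.sub (((memLp_of_norm_sub_le hf.nonneg (hf.norm_sub_v_le i) h1 h2).add
      (memLp_noise_and_le hξ hq (centredNoise_noiseV hg hf) i ht hk).1).const_smul γv)
    exact ⟨(memLp_congr_ae (.of_forall fun ω => (hround ω).qu_succ i k)).2 hu,
      (memLp_congr_ae (.of_forall fun ω => (hround ω).qv_succ i k)).2 hv⟩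

lemma memLp_iterate (hn : 1 ≤ n) (hξ : Samples P D T K ξ) (hg : StochGrad F D σu σv)
    (hf : LipschitzGrads (clientObj F D) (fun i => gradU (clientObj F D i))
      (fun i => gradV (clientObj F D i)) L)
    (hγu : γu * ηu = γ) (hγv : γv * ηv = γ) {t : ℕ} (ht : t ≤ T) :
    MemLp (fun ω => (iterate F γu γv ηu ηv K u0 v0 ξ t ω).1) 2 P ∧
      ∀ i, MemLp (fun ω => (iterate F γu γv ηu ηv K u0 v0 ξ t ω).2 i) 2 P := by
  induction t with
  | zero => exact ⟨memLp_const u0, fun i => memLp_const (v0 i)⟩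
  | succ t ih =>
    obtain ⟨hx, hy⟩ := ih (t.le_succ.trans ht)
    set q := localPoint F γu γv ξ (iterate F γu γv ηu ηv K u0 v0 ξ) with hqdef
    have hround := fun ω => noisyRound_iterate (F := F) (D := D) (K := K) (u0 := u0) (v0 := v0)
      (ξ := ξ) hn hγu hγv t ω
    have hq : Nonanticipating T K ξ q := nonanticipating_localPoint hg
    have hloc := fun i k (hk : k ∈ Finset.range K) =>
      memLp_localPoint (k := k) hn hξ hg hf hγu hγv ht hx hy i (Finset.mem_range.1 hk).le
    have hu := fun i => memLp_finsetSum (Finset.range K) fun k hk =>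
      (memLp_of_norm_sub_le hf.nonneg (hf.norm_sub_u_le i) (hloc i k hk).1 (hloc i k hk).2).add
        (memLp_noise_and_le hξ hq (centredNoise_noiseU hg hf) i ht (Finset.mem_range.1 hk)).1
    have hv := fun i => memLp_finsetSum (Finset.range K) fun k hk =>
      (memLp_of_norm_sub_le hf.nonneg (hf.norm_sub_v_le i) (hloc i k hk).1 (hloc i k hk).2).add
        (memLp_noise_and_le hξ hq (centredNoise_noiseV hg hf) i ht (Finset.mem_range.1 hk)).1
    refine ⟨(memLp_congr_ae (.of_forall fun ω => (hround ω).x_eq)).2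
      (hx.sub (((memLp_finsetSum Finset.univ fun i _ => hu i).const_smul (1 / (n : ℝ))).const_smul
        γ)), fun i => (memLp_congr_ae (.of_forall fun ω => (hround ω).y_eq i)).2
      ((hy i).sub ((hv i).const_smul γ))⟩

lemma measurable_others_iterate (hg : StochGrad F D σu σv) (p : Fin n × Fin T × Fin K) :
    Measurable[othersAlgebra T K ξ p] (iterate F γu γv ηu ηv K u0 v0 ξ p.2.1) :=
  measurable_fedAvgP hg γu γv ηu ηv u0 v0 fun _ _ hs _ hl =>
    measurable_othersAlgebra (hs.trans p.2.1.2) hl (.inr (.inl hs.ne))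

/-- The expected squared gradient norm along FedAvg-P. -/
theorem sum_expGrad_le (hn : 1 ≤ n) (hK : 1 ≤ K) (hξ : Samples P D T K ξ)
    (hg : StochGrad F D σu σv)
    (hf : LipschitzGrads (clientObj F D) (fun i => gradU (clientObj F D i))
      (fun i => gradV (clientObj F D i)) L)
    (hbdd : BddBelow (Set.range fun p : Vec du × (Fin n → Vec dv) => globalObj F D p.1 p.2))
    (hgap : 0 ≤ initialGap F D u0 v0) (hL : 0 < L)
    (hγ : 0 < γ) (hγu : γu * ηu = γ) (hγv : γv * ηv = γ) (hx : L * K * γ ≤ 1 / 84)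
    (hηT : (T : ℝ) ^ 2 ≤ ηu ^ 2) (hηn : (n : ℝ) ≤ ηu ^ 2) (hηv : 1 ≤ ηv ^ 2)
    (hηB : initialGradSum F D u0 v0 * T ≤ ηu ^ 2 * (n * L * initialGap F D u0 v0)) :
    γ * K / 4 * ∑ t ∈ Finset.range T,
        (expGradU F D P (iterate F γu γv ηu ηv K u0 v0 ξ t) +
          expGradV F D P (iterate F γu γv ηu ηv K u0 v0 ξ t)) ≤
      initialGap F D u0 v0 + γ * K / 4 * (L * initialGap F D u0 v0) +
        11 * L * γ ^ 2 * K * T * (σu ^ 2 / n + σv ^ 2) := by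
  have hn' : (0 : ℝ) < n := by exact_mod_cast hn
  set F0 := initialGap F D u0 v0 with hF0
  set X := iterate F γu γv ηu ηv K u0 v0 ξ with hX
  set q := localPoint F γu γv ξ X with hqdef
  set Gu := fun i => gradU (clientObj F D i) with hGu
  set Gv := fun i => gradV (clientObj F D i) with hGv
  set s := σu ^ 2 / n + σv ^ 2 with hs
  have hs0 : 0 ≤ s := by positivity
  have hq : Nonanticipating T K ξ q := nonanticipating_localPoint hg
  have hnu := centredNoise_noiseU hg hf
  have hnv := centredNoise_noiseV hg hf
  have hGum : ∀ i, Measurable fun p : Vec du × Vec dv => Gu i p.1 p.2 :=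
    fun i => measurable_of_norm_sub_le hf.nonneg (hf.norm_sub_u_le i)
  have hGvm : ∀ i, Measurable fun p : Vec du × Vec dv => Gv i p.1 p.2 :=
    fun i => measurable_of_norm_sub_le hf.nonneg (hf.norm_sub_v_le i)
  -- Multiplying by `γu ^ 2` turns the three lower bounds on `ηu ^ 2` into upper bounds on `γu ^ 2`
  -- in terms of `γ ^ 2`: `hu2n` for the noise, `huT` for the displacement, `hB` for the initial
  -- gradients.
  have hγ2 : γ ^ 2 = γu ^ 2 * ηu ^ 2 := by rw [← hγu]; ring
  have hu2n : γu ^ 2 * n ≤ γ ^ 2 := by rw [hγ2]; gcongr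
  have hu2 : γu ^ 2 ≤ γ ^ 2 := by
    refine le_trans ?_ hu2n
    exact le_mul_of_one_le_right (sq_nonneg _) (by exact_mod_cast hn)
  have hv2 : γv ^ 2 ≤ γ ^ 2 := by
    rw [← hγv, mul_pow]
    exact le_mul_of_one_le_right (sq_nonneg _) hηv
  have huT : γu ^ 2 * T ^ 2 ≤ γ ^ 2 := by rw [hγ2]; gcongr
  have hB : γu ^ 2 * (meanGradSq Gu u0 v0 * T) ≤ γ ^ 2 * (L * F0) := by
    have h1 : meanGradSq Gu u0 v0 * T = initialGradSum F D u0 v0 * T / n := by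
      simp only [meanGradSq, initialGradSum, hGu]
      ring
    rw [h1, hγ2, mul_assoc]
    gcongr
    rw [div_le_iff₀ hn']
    linarith
  have hpoint : ∀ ω, γ * K / 4 * ∑ t ∈ Finset.range T, gradSq Gu Gv (X t ω).1 (X t ω).2 ≤
      F0 + γ * K / 4 * (L * F0) +
        8 * γ * L ^ 2 * ∑ t ∈ Finset.range T, localNoiseSq K γu γv
          (fun i k => noiseU F D i (q i t k ω) (ξ i t k ω))
          (fun i k => noiseV F D i (q i t k ω) (ξ i t k ω)) +
        3 * L * γ ^ 2 * ∑ t ∈ Finset.range T, noiseSq K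
          (fun i k => noiseU F D i (q i t k ω) (ξ i t k ω))
          (fun i k => noiseV F D i (q i t k ω) (ξ i t k ω)) -
        γ * ∑ t ∈ Finset.range T, noiseInner Gu Gv K (X t ω).1 (X t ω).2
          (fun i k => noiseU F D i (q i t k ω) (ξ i t k ω))
          (fun i k => noiseV F D i (q i t k ω) (ξ i t k ω)) := fun ω => by
    refine sum_gradSq_le (x := fun t => (X t ω).1) (y := fun t => (X t ω).2) hn hK hf
      (fun t _ => noisyRound_iterate hn hγu hγv t ω) hγ hx hgap hu2 hv2 huT hB ?_
    have := ciInf_le hbdd (X T ω)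
    rw [hF0, initialGap]
    change globalObj F D u0 v0 - (globalObj F D u0 v0 - _) ≤ globalObj F D (X T ω).1 (X T ω).2
    linarith
  have hmemX := fun t (ht : t ∈ Finset.range T) => memLp_iterate (u0 := u0) (v0 := v0) hn hξ hg hf
    hγu hγv (Finset.mem_range.1 ht).le
  have hmemU := fun t ht i => memLp_of_norm_sub_le hf.nonneg (hf.norm_sub_u_le i) (hmemX t ht).1
    ((hmemX t ht).2 i)
  have hmemV := fun t ht i => memLp_of_norm_sub_le hf.nonneg (hf.norm_sub_v_le i) (hmemX t ht).1
    ((hmemX t ht).2 i)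
  have hG1 : ∀ t ∈ Finset.range T, Integrable
      (fun ω => ‖(1 / (n : ℝ)) • ∑ i, Gu i (X t ω).1 ((X t ω).2 i)‖ ^ 2) P := fun t ht =>
    integrable_norm_sq_of_memLp
      ((memLp_finsetSum Finset.univ fun i _ => hmemU t ht i).const_smul (1 / (n : ℝ)))
  have hG2 : ∀ t ∈ Finset.range T, ∀ i,
      Integrable (fun ω => ‖Gv i (X t ω).1 ((X t ω).2 i)‖ ^ 2) P := fun t ht i =>
    integrable_norm_sq_of_memLp (hmemV t ht i)
  have hG3 : ∀ t ∈ Finset.range T,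
      Integrable (fun ω => (1 / (n : ℝ)) * ∑ i, ‖Gv i (X t ω).1 ((X t ω).2 i)‖ ^ 2) P :=
    fun t ht => (integrable_finsetSum Finset.univ fun i _ => hG2 t ht i).const_mul _
  have hG : ∀ t ∈ Finset.range T, Integrable (fun ω => gradSq Gu Gv (X t ω).1 (X t ω).2) P :=
    fun t ht => (hG1 t ht).add (hG3 t ht)
  have hGeq : ∀ t ∈ Finset.range T, ∫ ω, gradSq Gu Gv (X t ω).1 (X t ω).2 ∂P =
      expGradU F D P (X t) + expGradV F D P (X t) := fun t ht => by
    simp only [gradSq]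
    rw [integral_add (hG1 t ht) (hG3 t ht), integral_const_mul,
      integral_finsetSum _ fun i _ => hG2 t ht i]
    simp only [expGradU, expGradV,
      globalGradU_eq fun i v u => (hf.hasGrad_u i u v).differentiableAt]
    rfl
  have hM := fun t (ht : t ∈ Finset.range T) =>
    integrable_localNoiseSq_and_le hn hξ hq hnu hnv γu γv (Finset.mem_range.1 ht)
  have hW := fun t (ht : t ∈ Finset.range T) =>
    integrable_noiseSq_and_le hn hξ hq hnu hnv (Finset.mem_range.1 ht)
  have hΛ := fun t (ht : t ∈ Finset.range T) =>
    integrable_noiseInner_and_eq_zero (Gu := Gu) (Gv := Gv) hξ hq hnu hnv (Finset.mem_range.1 ht)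
      (hmemU t ht) (hmemV t ht)
      (fun i p hp => by
        subst hp
        have h1 := measurable_others_iterate (u0 := u0) (v0 := v0) (γu := γu) (γv := γv)
          (ηu := ηu) (ηv := ηv) (ξ := ξ) hg p
        exact (hGum i).comp (h1.fst.prodMk ((measurable_pi_apply i).comp h1.snd)))
      (fun i p hp => by
        subst hp
        have h1 := measurable_others_iterate (u0 := u0) (v0 := v0) (γu := γu) (γv := γv)
          (ηu := ηu) (ηv := ηv) (ξ := ξ) hg p
        exact (hGvm i).comp (h1.fst.prodMk ((measurable_pi_apply i).comp h1.snd)))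
  have iG := (integrable_finsetSum (Finset.range T) hG).const_mul (γ * K / 4)
  have iM := (integrable_finsetSum (Finset.range T) fun t ht => (hM t ht).1).const_mul
    (8 * γ * L ^ 2)
  have iW := (integrable_finsetSum (Finset.range T) fun t ht => (hW t ht).1).const_mul
    (3 * L * γ ^ 2)
  have iΛ := (integrable_finsetSum (Finset.range T) fun t ht => (hΛ t ht).1).const_mul γ
  have iC : Integrable (fun _ : Ω => F0 + γ * K / 4 * (L * F0)) P := integrable_const _
  have hint := integral_mono iG (((iC.add iM).add iW).sub iΛ) hpoint
  rw [integral_sub' ((iC.add iM).add iW) iΛ, integral_add' (iC.add iM) iW, integral_add' iC iM,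
    integral_const_mul, integral_const_mul, integral_const_mul, integral_const_mul,
    integral_finsetSum _ hG, integral_finsetSum _ fun t ht => (hM t ht).1,
    integral_finsetSum _ fun t ht => (hW t ht).1, integral_finsetSum _ fun t ht => (hΛ t ht).1,
    Finset.sum_congr rfl hGeq, Finset.sum_eq_zero fun t ht => (hΛ t ht).2] at hint
  simp only [integral_const, probReal_univ, one_smul, mul_zero, sub_zero] at hint
  have hM' := Finset.sum_le_sum fun t ht => (hM t ht).2
  have hW' := Finset.sum_le_sum fun t ht => (hW t ht).2
  rw [Finset.sum_const, Finset.card_range, nsmul_eq_mul] at hM' hW'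
  -- The factor `1 / n` missing from the local `u`-noise is recovered from `γu ^ 2 * n ≤ γ ^ 2`.
  have hσ : γu ^ 2 * σu ^ 2 + γv ^ 2 * σv ^ 2 ≤ γ ^ 2 * s := by
    have h1 : γu ^ 2 * σu ^ 2 ≤ γ ^ 2 * (σu ^ 2 / n) := by
      have : γu ^ 2 * σu ^ 2 = (γu ^ 2 * n) * (σu ^ 2 / n) := by field_simp
      rw [this]
      gcongr
    have h2 : γv ^ 2 * σv ^ 2 ≤ γ ^ 2 * σv ^ 2 := by gcongr
    rw [hs]
    linarith
  have hM'' := hM'.trans (by gcongr :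
    (T : ℝ) * ((K : ℝ) ^ 2 * (γu ^ 2 * σu ^ 2 + γv ^ 2 * σv ^ 2)) ≤ T * (K ^ 2 * (γ ^ 2 * s)))
  have e1 := mul_le_mul_of_nonneg_left hM'' (by positivity : 0 ≤ 8 * γ * L ^ 2)
  have e2 := mul_le_mul_of_nonneg_left hW' (by positivity : 0 ≤ 3 * L * γ ^ 2)
  -- The local noise contributes `8 * (L * K * γ)` times `L * γ ^ 2 * K * T * s`, hence at most `8 /
  -- 84` of it; with the 3 from the round noise the total is well below 11.
  have e3 := mul_le_mul_of_nonneg_right hx (by positivity : 0 ≤ L * γ ^ 2 * K * T * s)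
  have e4 : 0 ≤ L * γ ^ 2 * K * T * s := by positivity
  linarith

end Algorithm

/-! ### Choice of the step size and conclusion. -/

/-- Write `1 / γ = 84 * L * K + R`. The first term splits exactly into `336 * L * F0 / T` and `4 *
F0 * R / (K * T)`. The root `R` is tuned so that `44 * L * s = 4 * F0 * R ^ 2 / (K * T)`, and `R * γ
≤ 1` bounds the noise term by the same quantity, also when `R = 0`. The two add up to the factor 8,
and `337 = 336 + 1`. -/
lemma average_bound_of_step_eq {L K T F0 s γ A : ℝ} (hL : 0 < L) (hK : 0 < K) (hT : 0 < T)
    (hF0 : 0 < F0) (hs : 0 ≤ s)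
    (hγ : γ = (84 * L * K + Real.sqrt (11 * L * K * T / F0 * s))⁻¹)
    (hA : A ≤ 4 * F0 / (T * K * γ) + 44 * L * s * γ + L * F0 / T) :
    A ≤ 8 * Real.sqrt (11 * L * F0 / (K * T) * s) + 337 * L * F0 / T := by
  set R := Real.sqrt (11 * L * K * T / F0 * s) with hR
  have hR0 : 0 ≤ R := Real.sqrt_nonneg _
  have hR2 : R ^ 2 = 11 * L * K * T / F0 * s := Real.sq_sqrt (by positivity)
  have hroot : Real.sqrt (11 * L * F0 / (K * T) * s) = F0 / (K * T) * R := by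
    rw [Real.sqrt_eq_iff_mul_self_eq (by positivity) (by positivity)]
    symm
    calc F0 / (K * T) * R * (F0 / (K * T) * R) = (F0 / (K * T)) ^ 2 * R ^ 2 := by ring
      _ = _ := by rw [hR2]; field_simp
  have h1 : 4 * F0 / (T * K * γ) = 336 * L * F0 / T + 4 * (F0 / (K * T) * R) := by
    rw [hγ]
    field_simp
    ring
  have h2 : 44 * L * s * γ ≤ 4 * (F0 / (K * T) * R) := by
    have h3 : 44 * L * s = 4 * (F0 / (K * T) * R) * R := by
      calc 44 * L * s = 4 * (F0 / (K * T)) * R ^ 2 := by rw [hR2]; field_simp; ring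
        _ = _ := by ring
    rw [h3, hγ, mul_assoc]
    refine mul_le_of_le_one_right (by positivity) ?_
    rw [← div_eq_mul_inv]
    exact div_le_one_of_le₀ (le_add_of_nonneg_left (by positivity)) (by positivity)
  rw [hroot]
  refine hA.trans ?_
  rw [h1]
  have : 337 * L * F0 / T = 336 * L * F0 / T + L * F0 / T := by ring
  linarith

end FedAvgP

end

theorem mainTheorem3 {du dv n : ℕ} {Ω Ξ : Type*} [MeasurableSpace Ω] [MeasurableSpace Ξ]
    (P : Measure Ω) [IsProbabilityMeasure P]
    (D : Fin n → Measure Ξ) [∀ i, IsProbabilityMeasure (D i)]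
    (F : FedAvgP.Vec du → FedAvgP.Vec dv → Ξ → ℝ)
    (T K : ℕ) (hn : 1 ≤ n) (hT : 1 ≤ T) (hK : 1 ≤ K)
    (u0 : FedAvgP.Vec du) (v0 : Fin n → FedAvgP.Vec dv)
    (ξ : Fin n → ℕ → ℕ → Ω → Ξ)
    (Lu Luv Lv Lvu : NNReal) (L σu σv : ℝ) (γ γu γv ηu ηv F0 B0 : ℝ)
    -- the objectives are well-defined expectations, and `f` is bounded below
    (hF : ∀ i u v, Integrable (F u v) (D i))
    (hbdd : BddBelow (Set.range fun p : FedAvgP.Vec du × (Fin n → FedAvgP.Vec dv) =>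
      FedAvgP.globalObj F D p.1 p.2))
    -- the assumptions
    (hsmooth : FedAvgP.Smooth (FedAvgP.clientObj F D) Lu Luv Lv Lvu)
    (hL : L = max (max (Lu : ℝ) (Lv : ℝ)) (max (Luv : ℝ) (Lvu : ℝ)))
    (hgrad : FedAvgP.StochGrad F D σu σv)
    (hξ : FedAvgP.Samples P D T K ξ)
    -- initial quantities
    (hF0 : F0 = FedAvgP.initialGap F D u0 v0) (hF0pos : 0 < F0)
    (hB0 : B0 = FedAvgP.initialGradSum F D u0 v0)
    -- step sizes
    (hγ : 0 < γ) (hγu : γu * ηu = γ) (hγv : γv * ηv = γ)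
    (hηu : max (max (T : ℝ) (Real.sqrt (B0 * T / (n * L * F0)))) (Real.sqrt n) ≤ ηu)
    (hηv : 1 ≤ ηv)
    -- the iterates of FedAvg-P when all clients participate in every round
    (X : ℕ → Ω → FedAvgP.Vec du × (Fin n → FedAvgP.Vec dv))
    (hX : ∀ t ω, X t ω = FedAvgP.fedAvgP F γu γv ηu ηv K (fun _ => Finset.univ) u0 v0
      (fun i s k => ξ i s k ω) t) :
    -- the expectations below are finite
    (∀ t < T, Integrable (fun ω => ‖FedAvgP.globalGradU F D (X t ω).1 (X t ω).2‖ ^ 2) P ∧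
      ∀ i, Integrable (fun ω =>
        ‖FedAvgP.gradV (FedAvgP.clientObj F D i) (X t ω).1 ((X t ω).2 i)‖ ^ 2) P) ∧
    (γ ≤ 1 / (84 * L * K) →
      (1 / (T : ℝ)) * ∑ t ∈ Finset.range T,
          (FedAvgP.expGradU F D P (X t) + FedAvgP.expGradV F D P (X t)) ≤
        4 * F0 / (T * K * γ) + 44 * L * (σu ^ 2 / n + σv ^ 2) * γ + L * F0 / T) ∧
    (γ = (84 * L * K + Real.sqrt (11 * L * K * T / F0 * (σu ^ 2 / n + σv ^ 2)))⁻¹ →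
      (1 / (T : ℝ)) * ∑ t ∈ Finset.range T,
          (FedAvgP.expGradU F D P (X t) + FedAvgP.expGradV F D P (X t)) ≤
        8 * Real.sqrt (11 * L * F0 / (K * T) * (σu ^ 2 / n + σv ^ 2)) + 337 * L * F0 / T) := by
  have hX' : X = FedAvgP.iterate F γu γv ηu ηv K u0 v0 ξ := funext fun t => funext fun ω => hX t ω
  subst hX' hF0 hB0
  have hf := hsmooth.lipschitzGrads hL
  have hn' : (0 : ℝ) < n := by exact_mod_cast hn
  have hT' : (1 : ℝ) ≤ T := by exact_mod_cast hT
  have hK' : (1 : ℝ) ≤ K := by exact_mod_cast hK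
  have hT0 : (0 : ℝ) < T := by linarith
  have hK0 : (0 : ℝ) < K := by linarith
  obtain ⟨⟨hηT, hηB⟩, hηn⟩ := by simpa only [max_le_iff] using hηu
  have hηu0 : 0 < ηu := by linarith
  set F0 := FedAvgP.initialGap F D u0 v0
  have main : γ ≤ 1 / (84 * L * K) →
      (1 / (T : ℝ)) * ∑ t ∈ Finset.range T,
          (FedAvgP.expGradU F D P (FedAvgP.iterate F γu γv ηu ηv K u0 v0 ξ t) +
            FedAvgP.expGradV F D P (FedAvgP.iterate F γu γv ηu ηv K u0 v0 ξ t)) ≤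
        4 * F0 / (T * K * γ) + 44 * L * (σu ^ 2 / n + σv ^ 2) * γ + L * F0 / T := by
    intro hγL
    -- For `L = 0` the bound `1 / (84 * L * K)` takes the default value 0, which contradicts `0 <
    -- γ`.
    have hL0 : 0 < L := by
      refine hf.nonneg.lt_of_ne fun h => ?_
      rw [← h] at hγL
      simp only [mul_zero, zero_mul, div_zero] at hγL
      exact hγ.not_ge hγL
    have hx : L * K * γ ≤ 1 / 84 := by
      rw [le_div_iff₀ (by positivity)] at hγL
      linarith
    have hB : FedAvgP.initialGradSum F D u0 v0 * T ≤ ηu ^ 2 * (n * L * F0) := by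
      have h1 := (Real.sqrt_le_left hηu0.le).1 hηB
      rwa [div_le_iff₀ (by positivity)] at h1
    have h := FedAvgP.sum_expGrad_le (P := P) (T := T) (K := K) (u0 := u0) (v0 := v0) hn hK hξ
      hgrad hf hbdd hF0pos.le hL0 hγ hγu hγv hx (pow_le_pow_left₀ hT0.le hηT 2)
      ((Real.sqrt_le_left hηu0.le).1 hηn) (one_le_pow₀ hηv) hB
    -- Scaling by `γ * K * T / 4` gives exactly the inequality of `sum_expGrad_le`; this is where
    -- `44 = 4 * 11` arises.
    refine le_of_mul_le_mul_left ?_ (by positivity : 0 < γ * K / 4 * T)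
    calc _ = γ * K / 4 * ∑ t ∈ Finset.range T,
          (FedAvgP.expGradU F D P (FedAvgP.iterate F γu γv ηu ηv K u0 v0 ξ t) +
            FedAvgP.expGradV F D P (FedAvgP.iterate F γu γv ηu ηv K u0 v0 ξ t)) := by field_simp
      _ ≤ _ := h
      _ = _ := by field_simp; ring
  refine ⟨fun t ht => ?_, main, fun hγeq => ?_⟩
  · obtain ⟨hx, hy⟩ := FedAvgP.memLp_iterate (u0 := u0) (v0 := v0) hn hξ hgrad hf hγu hγv ht.le
    refine ⟨?_, fun i => FedAvgP.integrable_norm_sq_of_memLp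
      (FedAvgP.memLp_of_norm_sub_le hf.nonneg (hf.norm_sub_v_le i) hx (hy i))⟩
    simp only [FedAvgP.globalGradU_eq hsmooth.diff_u]
    exact FedAvgP.integrable_norm_sq_of_memLp ((memLp_finsetSum Finset.univ fun i _ =>
      FedAvgP.memLp_of_norm_sub_le hf.nonneg (hf.norm_sub_u_le i) hx (hy i)).const_smul (1 / (n : ℝ)))
  -- For `L = 0` the prescribed step is the inverse of 0, which is 0 by convention and contradicts
  -- `0 < γ`.
  · have hL0 : 0 < L := by
      refine hf.nonneg.lt_of_ne fun h => ?_
      rw [← h] at hγeq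
      simp only [mul_zero, zero_mul, zero_div, Real.sqrt_zero, add_zero, inv_zero] at hγeq
      exact hγ.ne' hγeq
    refine FedAvgP.average_bound_of_step_eq hL0 hK0 hT0 hF0pos (by positivity) hγeq (main ?_)
    rw [hγeq, one_div]
    exact inv_anti₀ (by positivity) (le_add_of_nonneg_right (Real.sqrt_nonneg _))
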